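/- Let $n \ge 0$ and let $\varphi : \mathbf{D}^n \to [-\infty, \infty)$ be a plurisubharmonic (psh) function on the unit polydisk $\mathbf{D}^n = \{ z \in \mathbf{C}^n : |z_i| < 1 \text{ for all } i\}$ which is toric, i.e. $\varphi(z_1,\dots,z_n)$ depends only on $|z_1|, \dots, |z_n|$. (Psh means: upper semicontinuous, with the sub-mean value inequality on every closed disk contained in $\mathbf{D}^n$ and in a complex line; the constant $-\infty$ is allowed.) For a real number $c > 0$, let $\mathcal{J}(c\varphi)_0$ be the stalk at the origin of the multiplier ideal sheaf of $c\varphi$, i.e. the ideal of the ring of germs at $0$ of holomorphic functions that consists of the germs $u$ such that $|u|^2 e^{-2c\varphi}$ is Lebesgue integrable on some neighborhood of $0$. A real number $\alpha > 0$ is called a jumping number of $\varphi$ at $0$ if there is $\delta > 0$ such that, for real $c > 0$, one has $\mathcal{J}(c\varphi)_0 = \mathcal{J}(\alpha\varphi)_0$ precisely when $c \in [\alpha, \alpha + \delta)$, and moreover $\mathcal{J}((\alpha+\delta)\varphi)_0 \subsetneq \mathcal{J}(\alpha\varphi)_0$. If $c$ is a jumping number of $\varphi$ at $0$, then $mc$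 is also a jumping number of $\varphi$ at $0$ for every integer $m \ge 1$. -/

import Mathlib

open MeasureTheory Topology

/-- The unit polydisk `Dⁿ ⊆ ℂⁿ`, centred at the origin. -/
def unitPolydisk (n : ℕ) : Set (Fin n → ℂ) :=
  {z | ∀ i, ‖z i‖ < 1}

/-- The mean value `(1 / 2π) ∫₀^{2π} φ (a + e^{iθ} w) dθ` of an extended-real function over a
circle in the complex line through `a` in the direction `w`: the mean of the positive part minus
the mean of the negative part. If `φ` is bounded above on the circle, the first term is finite and
the value is a well-defined element of `[-∞, ∞)`. -/
noncomputable def circleMean {E : Type*} [AddCommGroup E] [Module ℂ E]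
    (φ : E → EReal) (a w : E) : EReal :=
  ((ENNReal.ofReal (2 * Real.pi)⁻¹ * ∫⁻ θ : ℝ in Set.Ioc 0 (2 * Real.pi),
      (φ (a + Complex.exp ((θ : ℂ) * Complex.I) • w)).toENNReal : ENNReal) : EReal) -
    ((ENNReal.ofReal (2 * Real.pi)⁻¹ * ∫⁻ θ : ℝ in Set.Ioc 0 (2 * Real.pi),
      (-φ (a + Complex.exp ((θ : ℂ) * Complex.I) • w)).toENNReal : ENNReal) : EReal)

/-- `φ : Ω → [-∞, ∞)` is plurisubharmonic: it is upper semicontinuous, never takes the value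
`+∞`, and satisfies the sub-mean value inequality on every closed disk that lies in `Ω` and in a
complex line. (The constant `-∞` is allowed.) -/
structure IsPlurisubharmonicOn {E : Type*} [NormedAddCommGroup E] [NormedSpace ℂ E]
    (φ : E → EReal) (Ω : Set E) : Prop where
  upperSemicontinuousOn : UpperSemicontinuousOn φ Ω
  lt_top : ∀ z ∈ Ω, φ z < ⊤
  le_circleMean : ∀ a w : E, (∀ ζ : ℂ, ‖ζ‖ ≤ 1 → a + ζ • w ∈ Ω) → φ a ≤ circleMean φ a w

/-- `φ` is toric (multi-circled) on `Ω`: its value at `z` depends only on `|z₁|, …, |zₙ|`. -/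
def IsToricOn {n : ℕ} (φ : (Fin n → ℂ) → EReal) (Ω : Set (Fin n → ℂ)) : Prop :=
  ∀ z ∈ Ω, ∀ w ∈ Ω, (∀ i, ‖z i‖ = ‖w i‖) → φ z = φ w

/-- The ring of germs at `x` of holomorphic functions. -/
def HolomorphicGerm {n : ℕ} (x : Fin n → ℂ) : Subring (Filter.Germ (𝓝 x) ℂ) where
  carrier := {g | ∃ f : (Fin n → ℂ) → ℂ, AnalyticAt ℂ f x ∧ (f : Filter.Germ (𝓝 x) ℂ) = g}
  mul_mem' := by
    rintro _ _ ⟨f, hf, rfl⟩ ⟨g, hg, rfl⟩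
    exact ⟨f * g, hf.mul hg, rfl⟩
  one_mem' := ⟨1, analyticAt_const, rfl⟩
  add_mem' := by
    rintro _ _ ⟨f, hf, rfl⟩ ⟨g, hg, rfl⟩
    exact ⟨f + g, hf.add hg, rfl⟩
  zero_mem' := ⟨0, analyticAt_const, rfl⟩
  neg_mem' := by
    rintro _ ⟨f, hf, rfl⟩
    exact ⟨-f, hf.neg, rfl⟩

/-- The measure `e^{-2ψ} dλ` on `ℂⁿ`, with `λ` the Lebesgue measure and `e^{-2ψ} = ∞` where
`ψ = -∞`. -/
noncomputable def weightMeasure {n : ℕ} (ψ : (Fin n → ℂ) → EReal) : Measure (Fin n → ℂ) :=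
  volume.withDensity fun z => EReal.exp (-(2 * ψ z))

/-- The stalk `𝓙(ψ)ₓ` of the multiplier ideal sheaf: the germs at `x` of holomorphic functions `f`
for which `|f|² e^{-2ψ}` is Lebesgue integrable on some neighbourhood of `x`. -/
noncomputable def multiplierIdeal {n : ℕ} (ψ : (Fin n → ℂ) → EReal) (x : Fin n → ℂ) :
    Ideal (HolomorphicGerm x) where
  carrier := {g | ∃ f : (Fin n → ℂ) → ℂ, (f : Filter.Germ (𝓝 x) ℂ) = g ∧
    ∃ U ∈ 𝓝 x, MemLp f 2 ((weightMeasure ψ).restrict U)}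
  add_mem' := by
    rintro a b ⟨f, hf, U, hU, hfU⟩ ⟨g, hg, V, hV, hgV⟩
    refine ⟨f + g, ?_, U ∩ V, Filter.inter_mem hU hV, ?_⟩
    · rw [Filter.Germ.coe_add, hf, hg]; rfl
    · exact (hfU.mono_measure (Measure.restrict_mono Set.inter_subset_left le_rfl)).add
        (hgV.mono_measure (Measure.restrict_mono Set.inter_subset_right le_rfl))
  zero_mem' := ⟨0, rfl, Set.univ, Filter.univ_mem, MemLp.zero⟩
  smul_mem' := by
    rintro ⟨_, h, hh, rfl⟩ b ⟨f, hf, U, hU, hfU⟩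
    refine ⟨h * f, by rw [Filter.Germ.coe_mul, hf]; rfl, ?_⟩
    have hbd : ∀ᶠ z in 𝓝 x, ‖h z‖ < ‖h x‖ + 1 :=
      hh.continuousAt.norm.eventually_lt_const (lt_add_one _)
    have hct : ∀ᶠ z in 𝓝 x, ContinuousAt h z :=
      hh.eventually_analyticAt.mono fun z hz => hz.continuousAt
    obtain ⟨V, hV, hVo, hxV⟩ := eventually_nhds_iff.1 (hbd.and hct)
    refine ⟨V ∩ U, Filter.inter_mem (hVo.mem_nhds hxV) hU, ?_⟩
    have hfV : MemLp f 2 ((weightMeasure ψ).restrict (V ∩ U)) :=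
      hfU.mono_measure (Measure.restrict_mono Set.inter_subset_right le_rfl)
    have hc : ContinuousOn h V := fun z hz => (hV z hz).2.continuousWithinAt
    have hm : AEStronglyMeasurable h ((weightMeasure ψ).restrict (V ∩ U)) :=
      (hc.aestronglyMeasurable hVo.measurableSet).mono_measure
        (Measure.restrict_mono Set.inter_subset_left le_rfl)
    have hae : ∀ᵐ z ∂((weightMeasure ψ).restrict (V ∩ U)), z ∈ V :=
      ae_mono (Measure.restrict_mono Set.inter_subset_left le_rfl)
        (ae_restrict_mem hVo.measurableSet)
    refine MemLp.of_le_mul (c := ‖h x‖ + 1) hfV (hm.mul hfV.1) ?_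
    filter_upwards [hae] with z hz
    rw [Pi.mul_apply, norm_mul]
    exact mul_le_mul_of_nonneg_right (hV z hz).1.le (norm_nonneg _)

/-- `α > 0` is a jumping number of `φ` at `x`: for some `δ > 0`, the real numbers `c > 0` with
`𝓙(cφ)ₓ = 𝓙(αφ)ₓ` are precisely those in `[α, α + δ)`, and `𝓙((α + δ)φ)ₓ ⊊ 𝓙(αφ)ₓ`. -/
def IsJumpingNumber {n : ℕ} (φ : (Fin n → ℂ) → EReal) (x : Fin n → ℂ) (α : ℝ) : Prop :=
  0 < α ∧ ∃ δ : ℝ, 0 < δ ∧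
    (∀ c : ℝ, 0 < c →
      (multiplierIdeal (fun z => (c : EReal) * φ z) x =
        multiplierIdeal (fun z => (α : EReal) * φ z) x ↔ c ∈ Set.Ico α (α + δ))) ∧
    multiplierIdeal (fun z => ((α + δ : ℝ) : EReal) * φ z) x <
      multiplierIdeal (fun z => (α : EReal) * φ z) x

/-! In logarithmic coordinates a toric psh `φ` becomes a convex function `g` on the negative
orthant, bounded above near `(-∞, …, -∞)`. If `g` is `-∞` at one point, it is `-∞` everywhere and
all multiplier ideals coincide, so there are no jumping numbers. Assume `g` is finite.

The ideals are monomial: averaging over rotations by roots of unity extracts each monomial of a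
germ, and conversely a germ is dominated by finitely many monomials of its support (Dickson's
lemma). For monomials there is a Howald-type criterion: `z^a` lies in `𝓙(cφ)₀` iff `∑ (aᵢ + 1) xᵢ -
c g(x)` is bounded above by a positive linear form in the negative coordinates `xᵢ`, plus a constant
(`HasDecay g (a + 1) c`). The shift by 1 comes from the area element.

This criterion is homogeneous in `(a + 1, c)`, and every `m (a + 1)` is again of the form `b + 1`
with `b` in `ℕⁿ`. Hence `𝓙(mcφ) ⊆ 𝓙(mc'φ)` implies `𝓙(cφ) ⊆ 𝓙(c'φ)`: a change of ideal between `c`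
and `c'` is visible between `mc` and `mc'`. So the ideal changes on arrival at `mc`, and it must
have dropped by `m(c + δ)`. Since `c ↦ 𝓙(cφ)₀` is decreasing and right-continuous, the first drop
after `mc` supplies the required interval. -/

/-! ### Sub-mean value inequality with real majorants. -/

section Submean

variable {E : Type*} [NormedAddCommGroup E] [NormedSpace ℂ E]

/-- A real continuous majorant of `φ` on a circle bounds `φ` at the centre by its mean. -/
theorem IsPlurisubharmonicOn.le_integral_of_le {φ : E → EReal} {Ω : Set E}
    (hφ : IsPlurisubharmonicOn φ Ω) {a w : E} (hdisk : ∀ ζ : ℂ, ‖ζ‖ ≤ 1 → a + ζ • w ∈ Ω)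
    {Ψ : ℝ → ℝ} (hΨ : Continuous Ψ)
    (hle : ∀ θ : ℝ, φ (a + Complex.exp ((θ : ℂ) * Complex.I) • w) ≤ (Ψ θ : EReal)) :
    φ a ≤ (((2 * Real.pi)⁻¹ * ∫ θ : ℝ in Set.Ioc 0 (2 * Real.pi), Ψ θ : ℝ) : EReal) := by
  refine (hφ.le_circleMean a w hdisk).trans ?_
  have hint : IntegrableOn Ψ (Set.Ioc 0 (2 * Real.pi)) := hΨ.integrableOn_Ioc
  have hpos : (0 : ℝ) ≤ (2 * Real.pi)⁻¹ := by positivity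
  have h1 : ∫⁻ θ : ℝ in Set.Ioc 0 (2 * Real.pi), ENNReal.ofReal (Ψ θ) ≠ ⊤ :=
    hint.lintegral_lt_top.ne
  have h2 : ∫⁻ θ : ℝ in Set.Ioc 0 (2 * Real.pi), ENNReal.ofReal (-Ψ θ) ≠ ⊤ :=
    hint.neg.lintegral_lt_top.ne
  -- Positive and negative parts are compared separately; for the continuous `Ψ` both are finite, so
  -- the extended difference is an ordinary one.
  have hkey : circleMean φ a w ≤
      ((ENNReal.ofReal (2 * Real.pi)⁻¹ * ∫⁻ θ : ℝ in Set.Ioc 0 (2 * Real.pi),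
        ENNReal.ofReal (Ψ θ) : ENNReal) : EReal) -
      ((ENNReal.ofReal (2 * Real.pi)⁻¹ * ∫⁻ θ : ℝ in Set.Ioc 0 (2 * Real.pi),
        ENNReal.ofReal (-Ψ θ) : ENNReal) : EReal) := by
    unfold circleMean
    apply EReal.sub_le_sub
    · rw [EReal.coe_ennreal_le_coe_ennreal_iff]
      gcongr with θ
      simpa using EReal.toENNReal_le_toENNReal (hle θ)
    · rw [EReal.coe_ennreal_le_coe_ennreal_iff]
      gcongr with θ
      have := EReal.toENNReal_le_toENNReal (EReal.neg_le_neg_iff.2 (hle θ))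
      rwa [← EReal.coe_neg, EReal.real_coe_toENNReal] at this
  refine hkey.trans (le_of_eq ?_)
  rw [integral_eq_lintegral_pos_part_sub_lintegral_neg_part hint]
  have e1 := ENNReal.mul_ne_top (a := ENNReal.ofReal (2 * Real.pi)⁻¹) ENNReal.ofReal_ne_top h1
  have e2 := ENNReal.mul_ne_top (a := ENNReal.ofReal (2 * Real.pi)⁻¹) ENNReal.ofReal_ne_top h2
  rw [← EReal.coe_toReal (x := ((ENNReal.ofReal (2 * Real.pi)⁻¹ * _ : ENNReal) : EReal))
      (by rw [ne_eq, EReal.coe_ennreal_eq_top_iff]; exact e1) (EReal.coe_ennreal_ne_bot _),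
    ← EReal.coe_toReal (x := ((ENNReal.ofReal (2 * Real.pi)⁻¹ *
      ∫⁻ θ : ℝ in Set.Ioc 0 (2 * Real.pi), ENNReal.ofReal (-Ψ θ) : ENNReal) : EReal))
      (by rw [ne_eq, EReal.coe_ennreal_eq_top_iff]; exact e2) (EReal.coe_ennreal_ne_bot _), ← EReal.coe_sub]
  congr 1
  simp only [EReal.toReal_coe_ennreal, ENNReal.toReal_mul, ENNReal.toReal_ofReal hpos]
  ring

end Submean

/-! ### Means of `log |1 + v e^{iθ}|` over the circle. -/

section LogCircle

theorem norm_one_add_mul_exp (v θ : ℝ) :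
    ‖1 + (v : ℂ) * Complex.exp ((θ : ℂ) * Complex.I)‖ =
      ‖Complex.exp ((θ : ℂ) * Complex.I) - (-v : ℂ)‖ := by
  have h : 1 + (v : ℂ) * Complex.exp ((θ : ℂ) * Complex.I) =
      Complex.exp ((θ : ℂ) * Complex.I) *
        (starRingEnd ℂ) (Complex.exp ((θ : ℂ) * Complex.I) - (-v : ℂ)) := by
    rw [sub_neg_eq_add, map_add, Complex.conj_ofReal, ← Complex.exp_conj, mul_add,
      ← Complex.exp_add]
    simp [mul_comm]
  rw [h, norm_mul, RCLike.norm_conj, Complex.norm_exp_ofReal_mul_I, one_mul]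

/-- `log |1 + vζ|` is harmonic near the closed unit disk and vanishes at its centre. -/
theorem integral_log_norm_one_add {v : ℝ} (hv : |v| < 1) :
    ∫ θ : ℝ in Set.Ioc 0 (2 * Real.pi),
      Real.log ‖1 + (v : ℂ) * Complex.exp ((θ : ℂ) * Complex.I)‖ = 0 := by
  have h := circleAverage_log_norm_sub_const₀ (a := (-v : ℂ)) (by simpa using hv)
  rw [Real.circleAverage_def, smul_eq_zero] at h
  have h' := h.resolve_left (by positivity)
  rw [intervalIntegral.integral_of_le (by positivity)] at h'
  refine Eq.trans ?_ h'
  refine integral_congr_ae (Filter.Eventually.of_forall fun θ => ?_)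
  simp [norm_one_add_mul_exp, circleMap]

theorem one_add_mul_exp_ne_zero {v : ℝ} (hv : |v| < 1) (θ : ℝ) :
    1 + (v : ℂ) * Complex.exp ((θ : ℂ) * Complex.I) ≠ 0 := by
  intro h
  have : ‖(v : ℂ) * Complex.exp ((θ : ℂ) * Complex.I)‖ = 1 := by
    rw [eq_neg_of_add_eq_zero_right h]; simp
  rw [norm_mul, Complex.norm_exp_ofReal_mul_I, mul_one, Complex.norm_real, Real.norm_eq_abs] at this
  linarith

theorem abs_log_norm_one_add_sub_le {v : ℝ} (hv : |v| ≤ 1 / 2) (θ : ℝ) :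
    |Real.log ‖1 + (v : ℂ) * Complex.exp ((θ : ℂ) * Complex.I)‖ - v * Real.cos θ| ≤ v ^ 2 := by
  set z : ℂ := (v : ℂ) * Complex.exp ((θ : ℂ) * Complex.I) with hz
  have hn : ‖z‖ = |v| := by
    rw [hz, norm_mul, Complex.norm_exp_ofReal_mul_I, mul_one, Complex.norm_real, Real.norm_eq_abs]
  have hre : z.re = v * Real.cos θ := by
    rw [hz, Complex.re_ofReal_mul, Complex.exp_ofReal_mul_I_re]
  have h1 := Complex.norm_log_one_add_sub_self_le (z := z) (by rw [hn]; linarith)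
  have h2 := (Complex.abs_re_le_norm (Complex.log (1 + z) - z)).trans h1
  rw [Complex.sub_re, Complex.log_re, hre, hn] at h2
  refine h2.trans ?_
  have h3 : (1 - |v|)⁻¹ ≤ 2 := by
    rw [inv_le_comm₀ (by linarith) (by norm_num)]; linarith
  rw [sq_abs]
  nlinarith [sq_nonneg v]

theorem integral_cos_Ioc : ∫ θ : ℝ in Set.Ioc 0 (2 * Real.pi), Real.cos θ = 0 := by
  rw [← intervalIntegral.integral_of_le (by positivity)]; simp

theorem integral_cos_sq_Ioc :
    ∫ θ : ℝ in Set.Ioc 0 (2 * Real.pi), Real.cos θ ^ 2 = Real.pi := by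
  rw [← intervalIntegral.integral_of_le (by positivity), integral_cos_sq]; simp

theorem continuous_log_norm_one_add {v : ℝ} (hv : |v| < 1) :
    Continuous fun θ : ℝ => Real.log ‖1 + (v : ℂ) * Complex.exp ((θ : ℂ) * Complex.I)‖ := by
  refine Continuous.log (by fun_prop) fun θ => ?_
  exact norm_ne_zero_iff.2 (one_add_mul_exp_ne_zero hv θ)

end LogCircle

/-! ### A maximum principle in logarithmic coordinates. -/

section Touch

variable {n : ℕ} {φ : (Fin n → ℂ) → EReal}

/-- The point `(exp x₁, …, exp xₙ)`. -/
noncomputable def expPoint {n : ℕ} (x : Fin n → ℝ) : Fin n → ℂ := fun i => (Real.exp (x i) : ℂ)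

theorem norm_expPoint (x : Fin n → ℝ) (i : Fin n) : ‖expPoint x i‖ = Real.exp (x i) := by
  simp only [expPoint, Complex.norm_real, Real.norm_eq_abs, Real.abs_exp]

theorem expPoint_mem {x : Fin n → ℝ} (hx : ∀ i, x i < 0) : expPoint x ∈ unitPolydisk n := by
  intro i
  rw [norm_expPoint]
  exact Real.exp_lt_one_iff.2 (hx i)

/-- A toric psh function cannot be touched from above, in logarithmic coordinates, by a quadratic
polynomial that is strictly concave in one direction. -/
theorem not_touch_above (hφ : IsPlurisubharmonicOn φ (unitPolydisk n))
    (htoric : IsToricOn φ (unitPolydisk n)) {u v τ : Fin n → ℝ} (hu : ∀ i, u i < 0)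
    {m b ε K δ : ℝ} (hm : φ (expPoint u) = m) (hε : 0 < ε) (hK : 0 ≤ K) (hδ : 0 < δ)
    (h : ∀ (d : ℝ) (e : Fin n → ℝ), |d| < δ → ‖e‖ < δ → (∀ i, (u + d • v + e) i < 0) →
      φ (expPoint (u + d • v + e)) ≤
        ((m + (b * d - ε * d ^ 2) + K * ∑ i, (2 * τ i * e i + e i ^ 2) : ℝ) : EReal)) :
    False := by
  -- choose a small radius
  set S : ℝ := ∑ i, (v i) ^ 4 with hS
  obtain ⟨ρ, hρ0, hρ⟩ : ∃ ρ : ℝ, 0 < ρ ∧ (ρ < δ ∧ (∀ i, |ρ * v i| < 1 / 2) ∧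
      (∀ i, (ρ * v i) ^ 2 < δ) ∧ (∀ i, Real.exp (u i) * (1 + |ρ * v i|) < 1) ∧
      K * S * ρ ^ 2 < ε / 2) := by
    have : ∀ᶠ ρ : ℝ in 𝓝[>] 0, (ρ < δ ∧ (∀ i, |ρ * v i| < 1 / 2) ∧
      (∀ i, (ρ * v i) ^ 2 < δ) ∧ (∀ i, Real.exp (u i) * (1 + |ρ * v i|) < 1) ∧
      K * S * ρ ^ 2 < ε / 2) := by
      refine Filter.Eventually.filter_mono nhdsWithin_le_nhds ?_
      refine (gt_mem_nhds hδ).and ((Filter.eventually_all.2 fun i => ?_).and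
        ((Filter.eventually_all.2 fun i => ?_).and
        ((Filter.eventually_all.2 fun i => ?_).and ?_)))
      · exact ContinuousAt.eventually_lt (f := fun ρ : ℝ => |ρ * v i|) (g := fun _ => 1 / 2)
          (by fun_prop) (by fun_prop) (by simp)
      · exact ContinuousAt.eventually_lt (f := fun ρ : ℝ => (ρ * v i) ^ 2) (g := fun _ => δ)
          (by fun_prop) (by fun_prop) (by simpa using hδ)
      · exact ContinuousAt.eventually_lt (f := fun ρ : ℝ => Real.exp (u i) * (1 + |ρ * v i|))
          (g := fun _ => 1) (by fun_prop) (by fun_prop) (by simpa using hu i)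
      · exact ContinuousAt.eventually_lt (f := fun ρ : ℝ => K * S * ρ ^ 2) (g := fun _ => ε / 2)
          (by fun_prop) (by fun_prop) (by simpa using hε)
    obtain ⟨ρ, h1, h2⟩ := (this.and self_mem_nhdsWithin).exists
    exact ⟨ρ, h2, h1⟩
  obtain ⟨hρδ, hρv, hρv2, hdisk, hρε⟩ := hρ
  set L : Fin n → ℝ → ℝ := fun i θ =>
    Real.log ‖1 + ((ρ * v i : ℝ) : ℂ) * Complex.exp ((θ : ℂ) * Complex.I)‖ with hL
  have hLc : ∀ i, Continuous (L i) := fun i =>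
    continuous_log_norm_one_add (by linarith [hρv i])
  -- On the circle the logarithmic coordinates are `u + ρ cos θ • v + e θ`: a segment in direction
  -- `v` up to an error of order `ρ²`.
  set e : ℝ → Fin n → ℝ := fun θ i => L i θ - ρ * v i * Real.cos θ with he
  have heb : ∀ θ i, |e θ i| ≤ (ρ * v i) ^ 2 := fun θ i =>
    abs_log_norm_one_add_sub_le (hρv i).le θ
  set a := expPoint u with ha
  -- The test disk is `ζ ↦ aᵢ (1 + ρ vᵢ ζ)`.
  set w : Fin n → ℂ := fun i => ((ρ * v i : ℝ) : ℂ) * a i with hw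
  have hnorm : ∀ (ζ : ℂ) i, ‖(a + ζ • w) i‖ = Real.exp (u i) * ‖1 + ((ρ * v i : ℝ) : ℂ) * ζ‖ := by
    intro ζ i
    rw [← norm_expPoint u i, ← norm_mul]
    congr 1
    simp only [Pi.add_apply, Pi.smul_apply, hw, smul_eq_mul, ha]
    ring
  have hmem : ∀ ζ : ℂ, ‖ζ‖ ≤ 1 → a + ζ • w ∈ unitPolydisk n := by
    intro ζ hζ i
    rw [hnorm]
    refine lt_of_le_of_lt ?_ (hdisk i)
    gcongr
    refine (norm_add_le _ _).trans ?_
    rw [norm_mul, norm_one, Complex.norm_real, Real.norm_eq_abs]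
    nlinarith [abs_nonneg (ρ * v i)]
  set Ψ : ℝ → ℝ := fun θ => m + (b * (ρ * Real.cos θ) - ε * (ρ * Real.cos θ) ^ 2) +
    K * ∑ i, (2 * τ i * e θ i + (ρ * v i) ^ 4) with hΨ
  have hec : ∀ i, Continuous fun θ => e θ i := fun i => by
    have := hLc i
    simp only [he]; fun_prop
  have hΨc : Continuous Ψ := by
    simp only [hΨ]
    fun_prop
  have hle : ∀ θ : ℝ, φ (a + Complex.exp ((θ : ℂ) * Complex.I) • w) ≤ (Ψ θ : EReal) := by
    intro θ
    have hζ : ‖Complex.exp ((θ : ℂ) * Complex.I)‖ ≤ 1 := by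
      rw [Complex.norm_exp_ofReal_mul_I]
    have hpt : ∀ i, ‖(a + Complex.exp ((θ : ℂ) * Complex.I) • w) i‖ =
        ‖expPoint (u + (ρ * Real.cos θ) • v + e θ) i‖ := by
      intro i
      rw [hnorm, norm_expPoint]
      have : (u + (ρ * Real.cos θ) • v + e θ) i = u i + L i θ := by
        simp only [Pi.add_apply, Pi.smul_apply, he, smul_eq_mul]; ring
      rw [this, Real.exp_add, hL, Real.exp_log]
      exact norm_pos_iff.2 (one_add_mul_exp_ne_zero (by linarith [hρv i]) θ)
    have hneg : ∀ i, (u + (ρ * Real.cos θ) • v + e θ) i < 0 := by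
      intro i
      have := hmem _ hζ i
      rwa [hpt, norm_expPoint, Real.exp_lt_one_iff] at this
    rw [htoric _ (hmem _ hζ) _ (expPoint_mem hneg) hpt]
    refine (h (ρ * Real.cos θ) (e θ) ?_ ?_ hneg).trans ?_
    · rw [abs_mul, abs_of_pos hρ0]
      nlinarith [Real.abs_cos_le_one θ]
    · rw [pi_norm_lt_iff hδ]
      exact fun i => (heb θ i).trans_lt (hρv2 i)
    · rw [EReal.coe_le_coe_iff]
      simp only [hΨ]
      gcongr with i
      calc e θ i ^ 2 = |e θ i| ^ 2 := (sq_abs _).symm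
        _ ≤ ((ρ * v i) ^ 2) ^ 2 := by gcongr; exact heb θ i
        _ = (ρ * v i) ^ 4 := by ring
  have hmean := hφ.le_integral_of_le hmem hΨc hle
  rw [hm, EReal.coe_le_coe_iff] at hmean
  -- Essential: the term linear in `e` has order `ρ²`, like the gain `ερ²/2` from the concave term,
  -- and must average to zero. Only the `ρ⁴` contribution of `e²` remains.
  have hei : ∀ i, ∫ θ : ℝ in Set.Ioc 0 (2 * Real.pi), e θ i = 0 := by
    intro i
    simp only [he]
    rw [integral_sub (hLc i).integrableOn_Ioc (Continuous.integrableOn_Ioc (by fun_prop)),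
      integral_const_mul, integral_cos_Ioc,
      integral_log_norm_one_add (by linarith [hρv i])]
    simp
  have hI : ∫ θ : ℝ in Set.Ioc 0 (2 * Real.pi), Ψ θ =
      2 * Real.pi * m - ε * ρ ^ 2 * Real.pi + K * (2 * Real.pi * (ρ ^ 4 * S)) := by
    have hc1 : Continuous fun θ : ℝ => (b * ρ) * Real.cos θ := by fun_prop
    have hc2 : Continuous fun θ : ℝ => (ε * ρ ^ 2) * Real.cos θ ^ 2 := by fun_prop
    have hc3 : ∀ i, Continuous fun θ : ℝ => 2 * τ i * e θ i := fun i => by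
      have := hec i
      fun_prop
    have hΨe : Ψ = fun θ => (m + (b * ρ) * Real.cos θ - (ε * ρ ^ 2) * Real.cos θ ^ 2) +
        K * (∑ i, 2 * τ i * e θ i + ρ ^ 4 * S) := by
      funext θ
      simp only [hΨ, hS, Finset.sum_add_distrib, Finset.mul_sum, mul_pow]
      ring
    rw [hΨe, integral_add (Continuous.integrableOn_Ioc (by fun_prop))
      (Continuous.integrableOn_Ioc (by fun_prop)), integral_sub
      (Continuous.integrableOn_Ioc (by fun_prop)) hc2.integrableOn_Ioc, integral_add
      (Continuous.integrableOn_Ioc (by fun_prop)) hc1.integrableOn_Ioc, integral_const_mul,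
      integral_const_mul, integral_const_mul, integral_add
      (Continuous.integrableOn_Ioc (by fun_prop)) (Continuous.integrableOn_Ioc (by fun_prop)),
      integral_finsetSum _ (fun i _ => (hc3 i).integrableOn_Ioc), integral_cos_Ioc,
      integral_cos_sq_Ioc]
    simp only [integral_const_mul, hei]
    simp only [mul_zero, Finset.sum_const_zero, integral_const, measureReal_restrict_apply_univ,
      Real.volume_real_Ioc_of_le Real.two_pi_pos.le, smul_eq_mul]
    ring
  rw [hI] at hmean
  have hπ := Real.pi_pos
  have : (2 * Real.pi)⁻¹ * (2 * Real.pi * m - ε * ρ ^ 2 * Real.pi + K * (2 * Real.pi * (ρ ^ 4 * S)))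
      = m - ρ ^ 2 * (ε / 2 - K * S * ρ ^ 2) := by
    field_simp
    ring
  rw [this] at hmean
  have : 0 < ρ ^ 2 * (ε / 2 - K * S * ρ ^ 2) := mul_pos (by positivity) (by linarith)
  linarith

end Touch

/-! ### Moving real summands across extended-real inequalities. -/

theorem EReal.add_coe_le_coe_iff {X : EReal} {p q : ℝ} :
    X + (p : EReal) ≤ (q : EReal) ↔ X ≤ ((q - p : ℝ) : EReal) := by
  induction X
  · simp
  · rw [← EReal.coe_add, EReal.coe_le_coe_iff, EReal.coe_le_coe_iff]
    constructor <;> intro h <;> linarith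
  · simp only [EReal.top_add_coe, top_le_iff, EReal.coe_ne_top]

theorem EReal.coe_lt_add_coe_iff {X : EReal} {p q : ℝ} :
    (q : EReal) < X + (p : EReal) ↔ ((q - p : ℝ) : EReal) < X := by
  rw [← not_le, ← not_le, EReal.add_coe_le_coe_iff]

/-! ### Convexity of toric psh functions in logarithmic coordinates. -/

section Convexity

variable {n : ℕ} {φ : (Fin n → ℂ) → EReal}

theorem unitPolydisk_eq_ball (n : ℕ) : unitPolydisk n = Metric.ball 0 1 := by
  ext z
  simp [unitPolydisk, pi_norm_lt_iff]

theorem isOpen_unitPolydisk (n : ℕ) : IsOpen (unitPolydisk n) := by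
  rw [unitPolydisk_eq_ball]; exact Metric.isOpen_ball

theorem continuous_expPoint : Continuous (expPoint : (Fin n → ℝ) → Fin n → ℂ) := by
  unfold expPoint
  fun_prop

theorem IsPlurisubharmonicOn.upperSemicontinuousAt_expPoint
    (hφ : IsPlurisubharmonicOn φ (unitPolydisk n)) {x : Fin n → ℝ} (hx : ∀ i, x i < 0) :
    UpperSemicontinuousAt (fun x => φ (expPoint x)) x := by
  intro c hc
  have := hφ.upperSemicontinuousOn _ (expPoint_mem hx) c hc
  rw [(isOpen_unitPolydisk n).nhdsWithin_eq (expPoint_mem hx)] at this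
  exact continuous_expPoint.continuousAt.eventually this

/-- In logarithmic coordinates, a toric psh function is convex. -/
theorem logConvex_of_toric (hφ : IsPlurisubharmonicOn φ (unitPolydisk n))
    (htoric : IsToricOn φ (unitPolydisk n)) {x y : Fin n → ℝ} (hx : ∀ i, x i < 0)
    (hy : ∀ i, y i < 0) {A B t : ℝ} (ht0 : 0 ≤ t) (ht1 : t ≤ 1)
    (hA : φ (expPoint x) ≤ A) (hB : φ (expPoint y) ≤ B) :
    φ (expPoint (x + t • (y - x))) ≤ ((A + t * (B - A) : ℝ) : EReal) := by
  by_contra hcon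
  rw [not_le] at hcon
  obtain ⟨m', hm1, hm2⟩ := EReal.lt_iff_exists_real_btwn.1 hcon
  rw [EReal.coe_lt_coe_iff] at hm1
  set v := y - x with hv
  -- Half of the excess over the chord pays for the strictly concave perturbation `κ s(1 - s)`, the
  -- other half for a margin at the endpoints.
  obtain ⟨κ, hκ, hκm⟩ : ∃ κ : ℝ, 0 < κ ∧ A + t * (B - A) + κ * (t * (1 - t)) + κ ≤ m' := by
    refine ⟨(m' - (A + t * (B - A))) / 2, by linarith, ?_⟩
    nlinarith [mul_nonneg ht0 (sub_nonneg.2 ht1), mul_pos (sub_pos.2 hm1)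
      (show 0 < 1 - t * (1 - t) by nlinarith [sq_nonneg t])]
  set G : (Fin n → ℝ) → EReal := fun x => φ (expPoint x) with hG
  -- the tube
  have hA' : G x < ((A + κ : ℝ) : EReal) :=
    hA.trans_lt (EReal.coe_lt_coe_iff.2 (by linarith))
  have hB' : G y < ((B + κ : ℝ) : EReal) :=
    hB.trans_lt (EReal.coe_lt_coe_iff.2 (by linarith))
  -- A full tube around the segment is needed because the test circles leave the segment
  -- transversally.
  obtain ⟨η, hη, hηp⟩ : ∃ η : ℝ, 0 < η ∧ ∀ τ : Fin n → ℝ, ‖τ‖ ≤ η →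
      (∀ i, x i + τ i < 0) ∧ (∀ i, y i + τ i < 0) ∧ G (x + τ) < ((A + κ : ℝ) : EReal) ∧
        G (y + τ) < ((B + κ : ℝ) : EReal) := by
    have hev : ∀ᶠ τ : Fin n → ℝ in 𝓝 0, (∀ i, x i + τ i < 0) ∧ (∀ i, y i + τ i < 0) ∧
        G (x + τ) < ((A + κ : ℝ) : EReal) ∧ G (y + τ) < ((B + κ : ℝ) : EReal) := by
      refine (Filter.eventually_all.2 fun i => ?_).and
        ((Filter.eventually_all.2 fun i => ?_).and (Filter.Eventually.and ?_ ?_))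
      · exact ContinuousAt.eventually_lt (f := fun τ : Fin n → ℝ => x i + τ i) (g := fun _ => 0)
          (by apply Continuous.continuousAt; fun_prop) (by fun_prop) (by simpa using hx i)
      · exact ContinuousAt.eventually_lt (f := fun τ : Fin n → ℝ => y i + τ i) (g := fun _ => 0)
          (by apply Continuous.continuousAt; fun_prop) (by fun_prop) (by simpa using hy i)
      · have hc : Filter.Tendsto (fun τ : Fin n → ℝ => x + τ) (𝓝 0) (𝓝 x) := by
          simpa using (continuous_const_add x).tendsto 0
        exact hc.eventually (hφ.upperSemicontinuousAt_expPoint hx _ hA')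
      · have hc : Filter.Tendsto (fun τ : Fin n → ℝ => y + τ) (𝓝 0) (𝓝 y) := by
          simpa using (continuous_const_add y).tendsto 0
        exact hc.eventually (hφ.upperSemicontinuousAt_expPoint hy _ hB')
    obtain ⟨r, hr, hrb⟩ := Metric.nhds_basis_closedBall.eventually_iff.1 hev
    exact ⟨r, hr, fun τ hτ => hrb (by simpa using hτ)⟩
  set C : Set (ℝ × (Fin n → ℝ)) := Set.Icc 0 1 ×ˢ Metric.closedBall 0 η with hC
  have hCc : IsCompact C := isCompact_Icc.prod (isCompact_closedBall _ _)
  have hneg : ∀ p ∈ C, ∀ i, (x + p.1 • v + p.2) i < 0 := by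
    rintro ⟨s, τ⟩ ⟨⟨hs0, hs1⟩, hτ⟩ i
    obtain ⟨h1, h2, -⟩ := hηp τ (by simpa using hτ)
    simp only [Pi.add_apply, Pi.smul_apply, hv, Pi.sub_apply, smul_eq_mul] at hs0 hs1 ⊢
    have e : x i + s * (y i - x i) + τ i = (1 - s) * (x i + τ i) + s * (y i + τ i) := by ring
    rw [e]
    rcases hs0.eq_or_lt with h | h
    · subst h; simpa using h1 i
    · nlinarith [mul_neg_of_pos_of_neg h (h2 i), h1 i]
  have hcont : Continuous fun p : ℝ × (Fin n → ℝ) => x + p.1 • v + p.2 := by fun_prop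
  have husc : UpperSemicontinuousOn (fun p : ℝ × (Fin n → ℝ) => G (x + p.1 • v + p.2)) C := by
    intro p hp c hc
    exact (hcont.continuousAt.eventually
      (hφ.upperSemicontinuousAt_expPoint (hneg p hp) c hc)).filter_mono nhdsWithin_le_nhds
  have hp0 : ((t, 0) : ℝ × (Fin n → ℝ)) ∈ C := ⟨⟨ht0, ht1⟩, by simpa using hη.le⟩
  obtain ⟨M, hM⟩ : ∃ M : ℝ, ∀ p ∈ C, G (x + p.1 • v + p.2) ≤ M := by
    obtain ⟨p, hp, hmax⟩ := husc.exists_isMaxOn ⟨_, hp0⟩ hCc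
    obtain ⟨M, hM, -⟩ := EReal.lt_iff_exists_real_btwn.1 (hφ.lt_top _ (expPoint_mem (hneg p hp)))
    exact ⟨M, fun q hq => (hmax hq).trans hM.le⟩
  -- Chosen so that on the lateral boundary `‖τ‖ = η` the penalty `K ∑ τᵢ²` outweighs the upper
  -- bound `M` of `G`.
  set K : ℝ := (|M| + |A| + |B|) / η ^ 2 with hK
  have hK0 : 0 ≤ K := by positivity
  have hKη : K * η ^ 2 = |M| + |A| + |B| := by rw [hK]; field_simp
  set P : ℝ × (Fin n → ℝ) → ℝ := fun p =>
    A + p.1 * (B - A) + κ * (p.1 * (1 - p.1)) + K * ∑ i, p.2 i ^ 2 with hP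
  have hPc : Continuous fun p => ((-P p : ℝ) : EReal) :=
    continuous_coe_real_ereal.comp (by simp only [hP]; fun_prop)
  have hFusc : UpperSemicontinuousOn
      (fun p : ℝ × (Fin n → ℝ) => G (x + p.1 • v + p.2) + ((-P p : ℝ) : EReal)) C :=
    husc.add' (hPc.upperSemicontinuous.upperSemicontinuousOn C) fun p _ =>
      EReal.continuousAt_add (Or.inr (EReal.coe_ne_bot _)) (Or.inr (EReal.coe_ne_top _))
  obtain ⟨⟨s, τ⟩, hp, hmax⟩ := hFusc.exists_isMaxOn ⟨_, hp0⟩ hCc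
  -- The maximum of `G - P` exceeds `κ`, which excludes every boundary point of the tube in what
  -- follows.
  have hval : ((κ + P (s, τ) : ℝ) : EReal) < G (x + s • v + τ) := by
    have h1 : (κ : EReal) < G (x + t • v + 0) + ((-P (t, 0) : ℝ) : EReal) := by
      rw [EReal.coe_lt_add_coe_iff, add_zero]
      refine lt_of_le_of_lt (EReal.coe_le_coe_iff.2 ?_) hm2
      simp only [hP, Pi.zero_apply]
      simp
      linarith
    have h2 := h1.trans_le (hmax hp0)
    rw [EReal.coe_lt_add_coe_iff, sub_neg_eq_add] at h2
    exact h2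
  obtain ⟨⟨hs0, hs1⟩, hτ⟩ := id hp
  simp only [mem_closedBall_zero_iff] at hs0 hs1 hτ
  have hsq : 0 ≤ K * ∑ i, τ i ^ 2 := mul_nonneg hK0 (Finset.sum_nonneg fun i _ => sq_nonneg _)
  have hs0' : 0 < s := by
    refine lt_of_le_of_ne hs0 ?_
    rintro rfl
    have := hval.trans ((by simpa using (hηp τ hτ).2.2.1) :
      G (x + (0 : ℝ) • v + τ) < ((A + κ : ℝ) : EReal))
    rw [EReal.coe_lt_coe_iff] at this
    simp only [hP] at this
    linarith
  have hs1' : s < 1 := by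
    refine lt_of_le_of_ne hs1 ?_
    rintro rfl
    have := hval.trans ((by simpa [hv] using (hηp τ hτ).2.2.2) :
      G (x + (1 : ℝ) • v + τ) < ((B + κ : ℝ) : EReal))
    rw [EReal.coe_lt_coe_iff] at this
    simp only [hP] at this
    linarith
  have hτ' : ‖τ‖ < η := by
    refine lt_of_le_of_ne hτ fun h => ?_
    have := hval.trans_le (hM _ hp)
    rw [EReal.coe_lt_coe_iff] at this
    have h1 : η ^ 2 ≤ ∑ i, τ i ^ 2 := by
      rw [← h]
      have : ‖τ‖ ≤ Real.sqrt (∑ i, τ i ^ 2) := by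
        rw [pi_norm_le_iff_of_nonneg (Real.sqrt_nonneg _)]
        intro i
        rw [Real.norm_eq_abs]
        exact Real.abs_le_sqrt (Finset.single_le_sum (f := fun i => τ i ^ 2)
          (fun i _ => sq_nonneg _) (Finset.mem_univ i))
      calc ‖τ‖ ^ 2 ≤ Real.sqrt (∑ i, τ i ^ 2) ^ 2 := by gcongr
        _ = _ := Real.sq_sqrt (Finset.sum_nonneg fun i _ => sq_nonneg _)
    have h2 := mul_le_mul_of_nonneg_left h1 hK0
    simp only [hP] at this
    have h3 : -(|A| + |B|) ≤ A + s * (B - A) := by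
      have e : A + s * (B - A) = (1 - s) * A + s * B := by ring
      rw [e]
      nlinarith [neg_abs_le A, neg_abs_le B, abs_nonneg A, abs_nonneg B]
    have h4 : 0 ≤ κ * (s * (1 - s)) := by
      have : 0 ≤ 1 - s := by linarith
      positivity
    linarith [le_abs_self M]
  have hu := hneg _ hp
  simp only at hu
  obtain ⟨m, hm⟩ : ∃ m : ℝ, φ (expPoint (x + s • v + τ)) = m := by
    refine ⟨(φ (expPoint (x + s • v + τ))).toReal, (EReal.coe_toReal ?_ ?_).symm⟩
    · exact (hφ.lt_top _ (expPoint_mem hu)).ne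
    · exact (hval.trans_le' bot_le).ne'
  -- At the interior maximum `P`, up to a constant, touches `G` from above; `b` is the
  -- `s`-derivative of `P`, and its exact second-order term is `-κ d²`.
  refine not_touch_above hφ htoric (u := x + s • v + τ) (v := v) (τ := τ) hu
    (b := B - A + κ * (1 - 2 * s)) (K := K) (δ := min (min s (1 - s)) (η - ‖τ‖)) hm hκ hK0
    (lt_min (lt_min hs0' (by linarith)) (by linarith)) ?_
  intro d e hd he _
  have hd1 := abs_lt.1 (hd.trans_le ((min_le_left _ _).trans (min_le_left _ _)))
  have hd2 := abs_lt.1 (hd.trans_le ((min_le_left _ _).trans (min_le_right _ _)))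
  have he1 := he.trans_le (min_le_right _ _)
  have hmem : ((s + d, τ + e) : ℝ × (Fin n → ℝ)) ∈ C := by
    refine ⟨⟨by simp only; linarith, by simp only; linarith⟩, ?_⟩
    rw [mem_closedBall_zero_iff]
    exact (norm_add_le _ _).trans (by linarith)
  have h1 := hmax hmem
  simp only [Set.mem_ofPred_eq] at h1
  rw [show G (x + s • v + τ) = (m : EReal) from hm, ← EReal.coe_add,
    EReal.add_coe_le_coe_iff] at h1
  have e1 : x + s • v + τ + d • v + e = x + (s + d) • v + (τ + e) := by
    rw [add_smul]; abel
  rw [e1]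
  refine h1.trans (le_of_eq ?_)
  congr 1
  simp only [hP, Pi.add_apply, add_sq, Finset.sum_add_distrib]
  ring

end Convexity

/-! ### Finite everywhere or `-∞` everywhere on the open torus. -/

section Dichotomy

variable {n : ℕ} {φ : (Fin n → ℂ) → EReal}

/-- Prolong the segment from `x` beyond `y`. Then `y` is an interior point, and convexity applies
with an arbitrarily negative bound at the end `x`. -/
theorem eq_bot_of_eq_bot (hφ : IsPlurisubharmonicOn φ (unitPolydisk n))
    (htoric : IsToricOn φ (unitPolydisk n)) {x y : Fin n → ℝ} (hx : ∀ i, x i < 0)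
    (hy : ∀ i, y i < 0) (hbot : φ (expPoint x) = ⊥) : φ (expPoint y) = ⊥ := by
  obtain ⟨s, hs0, hs⟩ : ∃ s : ℝ, 0 < s ∧ ∀ i, (y + s • (y - x)) i < 0 := by
    have hev : ∀ᶠ s : ℝ in 𝓝[>] 0, ∀ i, (y + s • (y - x)) i < 0 := by
      refine Filter.Eventually.filter_mono nhdsWithin_le_nhds (Filter.eventually_all.2 fun i => ?_)
      exact ContinuousAt.eventually_lt (f := fun s : ℝ => (y + s • (y - x)) i) (g := fun _ => 0)
        (by simp only [Pi.add_apply, Pi.smul_apply]; fun_prop) (by fun_prop) (by simpa using hy i)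
    obtain ⟨s, h1, h2⟩ := (hev.and self_mem_nhdsWithin).exists
    exact ⟨s, h2, h1⟩
  set z := y + s • (y - x) with hz
  obtain ⟨B, hB, -⟩ := EReal.lt_iff_exists_real_btwn.1 (hφ.lt_top _ (expPoint_mem hs))
  have ht : 0 < 1 + s := by linarith
  have hyx : y = x + (1 + s)⁻¹ • (z - x) := by
    have : z - x = (1 + s) • (y - x) := by rw [hz, add_smul, one_smul]; abel
    rw [this, smul_smul, inv_mul_cancel₀ ht.ne', one_smul]; abel
  rw [EReal.eq_bot_iff_forall_lt]
  intro r
  have ht1 : (1 + s)⁻¹ < 1 := inv_lt_one_of_one_lt₀ (by linarith)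
  set l := (1 + s)⁻¹ with hl
  have h1 : 0 < 1 - l := by linarith
  -- This `A` makes the interpolated bound at `y` equal to `r - 1`.
  have h := logConvex_of_toric hφ htoric (A := (r - 1 - l * B) / (1 - l)) (B := B) hx hs
    (inv_pos.2 ht).le ht1.le (by rw [hbot]; exact bot_le) hB.le
  rw [← hl, ← hyx] at h
  refine h.trans_lt (EReal.coe_lt_coe_iff.2 ?_)
  have : (r - 1 - l * B) / (1 - l) + l * (B - (r - 1 - l * B) / (1 - l)) = r - 1 := by
    field_simp
    ring
  linarith

end Dichotomy

/-! ### Linear decay of convex profiles. -/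

section Decay

variable {n : ℕ} {g : (Fin n → ℝ) → ℝ}

/-- `g` is convex on the negative orthant and bounded above near `(-∞, …, -∞)`. -/
structure IsLogProfile {n : ℕ} (g : (Fin n → ℝ) → ℝ) (R M : ℝ) : Prop where
  nonneg : 0 ≤ R
  convex : ∀ x y : Fin n → ℝ, (∀ i, x i < 0) → (∀ i, y i < 0) → ∀ t : ℝ, 0 ≤ t → t ≤ 1 →
    g (x + t • (y - x)) ≤ g x + t * (g y - g x)
  bounded : ∀ x : Fin n → ℝ, (∀ i, x i < -R) → g x ≤ M

/-- A convex function bounded above on the ray from `y` through `x` cannot increase along it: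
compare with a point `k + 1` times as far and let `k → ∞`. -/
theorem IsLogProfile.mono {R M : ℝ} (hg : IsLogProfile g R M) {x y : Fin n → ℝ}
    (hxy : x ≤ y) (hy : ∀ i, y i < -R) : g x ≤ g y := by
  have hR := hg.nonneg
  have key : ∀ k : ℕ, g x ≤ g y + (1 / ((k : ℝ) + 1)) * (M - g y) := by
    intro k
    have hk : (0 : ℝ) < (k : ℝ) + 1 := by positivity
    set z := y + ((k : ℝ) + 1) • (x - y) with hz
    have hzy : ∀ i, z i < -R := by
      intro i
      have : z i ≤ y i := by
        simp only [hz, Pi.add_apply, Pi.smul_apply, Pi.sub_apply, smul_eq_mul]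
        nlinarith [hxy i]
      exact this.trans_lt (hy i)
    have hx : x = y + (1 / ((k : ℝ) + 1)) • (z - y) := by
      rw [hz, add_sub_cancel_left, smul_smul, one_div, inv_mul_cancel₀ hk.ne', one_smul]; abel
    have h := hg.convex y z (fun i => (hy i).trans_le (by linarith))
      (fun i => (hzy i).trans_le (by linarith)) (1 / ((k : ℝ) + 1)) (by positivity)
      (by rw [div_le_one hk]; linarith [Nat.cast_nonneg (α := ℝ) k])
    rw [← hx] at h
    refine h.trans ?_
    gcongr
    exact hg.bounded z hzy
  have hlim : Filter.Tendsto (fun k : ℕ => g y + (1 / ((k : ℝ) + 1)) * (M - g y)) Filter.atTop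
      (𝓝 (g y + 0 * (M - g y))) :=
    (tendsto_one_div_add_atTop_nhds_zero_nat.mul_const _).const_add _
  simpa using ge_of_tendsto' hlim key

/-- The exponential integrability of `∑ tᵢ xᵢ - c g` near `(-∞, …, -∞)`, expressed as a linear
bound. -/
def HasDecay {n : ℕ} (g : (Fin n → ℝ) → ℝ) (t : Fin n → ℝ) (c : ℝ) : Prop :=
  ∃ R A B : ℝ, 0 < B ∧ ∀ x : Fin n → ℝ, (∀ i, x i < -R) →
    ∑ i, (t i - B) * x i - A ≤ c * g x

theorem HasDecay.smul {t : Fin n → ℝ} {c m : ℝ} (hm : 0 < m) (h : HasDecay g t c) :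
    HasDecay g (m • t) (m * c) := by
  obtain ⟨R, A, B, hB, h⟩ := h
  refine ⟨R, m * A, m * B, by positivity, fun x hx => ?_⟩
  have := mul_le_mul_of_nonneg_left (h x hx) hm.le
  rw [mul_sub, Finset.mul_sum] at this
  rw [mul_assoc]
  refine le_trans (le_of_eq ?_) this
  congr 1
  refine Finset.sum_congr rfl fun i _ => ?_
  simp only [Pi.smul_apply, smul_eq_mul]
  ring

/-- This homogeneity is the source of the passage from `c` to `m * c`. -/
theorem hasDecay_smul_iff {t : Fin n → ℝ} {c m : ℝ} (hm : 0 < m) :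
    HasDecay g (m • t) (m * c) ↔ HasDecay g t c := by
  refine ⟨fun h => ?_, HasDecay.smul hm⟩
  have := h.smul (inv_pos.2 hm)
  rwa [smul_smul, ← mul_assoc, inv_mul_cancel₀ hm.ne', one_smul, one_mul] at this

theorem HasDecay.anti {R M : ℝ} (hg : IsLogProfile g R M) {t : Fin n → ℝ} {c c' : ℝ}
    (hc : c' ≤ c) (h : HasDecay g t c) : HasDecay g t c' := by
  obtain ⟨R', A, B, hB, h⟩ := h
  refine ⟨max R R', A + (c - c') * M, B, hB, fun x hx => ?_⟩
  have h1 := h x fun i => (hx i).trans_le (neg_le_neg (le_max_right _ _))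
  have h2 := hg.bounded x fun i => (hx i).trans_le (neg_le_neg (le_max_left _ _))
  nlinarith [mul_le_mul_of_nonneg_left h2 (sub_nonneg.2 hc)]

theorem HasDecay.mono {t t' : Fin n → ℝ} {c : ℝ} (ht : t ≤ t') (h : HasDecay g t c) :
    HasDecay g t' c := by
  obtain ⟨R, A, B, hB, h⟩ := h
  refine ⟨max R 0, A, B, hB, fun x hx => ?_⟩
  refine le_trans ?_ (h x fun i => (hx i).trans_le (neg_le_neg (le_max_left _ _)))
  gcongr ?_ - A
  refine Finset.sum_le_sum fun i _ => ?_
  have hxi : x i ≤ 0 := (hx i).le.trans (neg_nonpos.2 (le_max_right _ _))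
  nlinarith [ht i]

/-- Openness in `c`: multiplying the bound by `1 + μ` tilts the linear form by `O(μ)`, which half of
the strict margin `B` absorbs. -/
theorem HasDecay.exists_gt {t : Fin n → ℝ} {c : ℝ} (hc : 0 < c) (h : HasDecay g t c) :
    ∃ ε > 0, HasDecay g t (c + ε) := by
  obtain ⟨R, A, B, hB, h⟩ := h
  set S : ℝ := 1 + ∑ i, |t i| with hS
  have hsum : 0 ≤ ∑ i, |t i| := Finset.sum_nonneg fun i _ => abs_nonneg _
  have hS0 : 0 < S := by linarith
  set μ : ℝ := B / (2 * S) with hμ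
  have hμ0 : 0 < μ := by positivity
  have hμS : μ * S = B / 2 := by rw [hμ]; field_simp
  refine ⟨c * μ, by positivity, max R 0, (1 + μ) * A, B / 2, by positivity, fun x hx => ?_⟩
  have h1 := h x fun i => (hx i).trans_le (neg_le_neg (le_max_left _ _))
  have h2 := mul_le_mul_of_nonneg_left h1 (by positivity : 0 ≤ 1 + μ)
  have e : (c + c * μ) * g x = (1 + μ) * (c * g x) := by ring
  rw [e]
  refine le_trans ?_ h2
  rw [mul_sub, Finset.mul_sum]
  gcongr ?_ - _
  refine Finset.sum_le_sum fun i _ => ?_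
  have hxi : x i ≤ 0 := (hx i).le.trans (neg_nonpos.2 (le_max_right _ _))
  have hti : |t i| ≤ S := by
    have := Finset.single_le_sum (f := fun i => |t i|) (fun i _ => abs_nonneg _)
      (Finset.mem_univ i)
    linarith
  have h3 : μ * (t i - B) ≤ B / 2 := by
    rw [← hμS]
    gcongr
    linarith [le_abs_self (t i)]
  nlinarith

/-- Finiteness of superlevel sets on a lattice already gives linear decay. -/
theorem IsLogProfile.hasDecay_of_finite {R M : ℝ} (hg : IsLogProfile g R M) {t : Fin n → ℝ}
    (ht : ∀ i, 0 ≤ t i) {c : ℝ} (hc : 0 ≤ c) {q : ℝ} (hq : q < -R)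
    (hfin : {k : Fin n → ℕ | c * g (fun i => q - k i) + ∑ i, t i * k i ≤
      c * g (fun _ => q) + ∑ i, t i + 1}.Finite) : HasDecay g t c := by
  have hR := hg.nonneg
  set H : (Fin n → ℝ) → ℝ := fun y => c * g (fun i => q - y i) + ∑ i, t i * y i with hH
  -- Outside a finite set of lattice points `H` exceeds `H 0` by more than `∑ tᵢ + 1`: the `∑ tᵢ` is
  -- lost when rounding to the lattice, and the 1 yields the slope `1 / N`.
  obtain ⟨N, hN0, hN⟩ : ∃ N : ℝ, 0 < N ∧ ∀ k : Fin n → ℕ, N ≤ ∑ i, (k i : ℝ) →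
      H 0 + ∑ i, t i + 1 < H fun i => (k i : ℝ) := by
    obtain ⟨N, hN⟩ := (hfin.image fun k => ∑ i, (k i : ℝ)).bddAbove
    refine ⟨|N| + 1, by positivity, fun k hk => ?_⟩
    by_contra hcon
    have := hN ⟨k, by simpa [hH] using hcon, rfl⟩
    simp only at this
    linarith [le_abs_self N]
  have hneg : ∀ y : Fin n → ℝ, 0 ≤ y → ∀ i, q - y i < -R := fun y hy i => by
    have : 0 ≤ y i := hy i
    linarith
  have main : ∀ y : Fin n → ℝ, 0 ≤ y →
      (∑ i, y i) / N - (1 + |H 0| + |c * g fun _ => q - N|) ≤ H y := by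
    intro y hy
    have hσ : 0 ≤ ∑ i, y i := Finset.sum_nonneg fun i _ => hy i
    rcases le_or_gt (∑ i, y i) N with h | h
    · have h1 : (∑ i, y i) / N ≤ 1 := by rwa [div_le_one hN0]
      have h2 : g (fun _ => q - N) ≤ g (fun i => q - y i) := by
        refine hg.mono (fun i => ?_) (hneg y hy)
        have := Finset.single_le_sum (f := y) (fun i _ => hy i) (Finset.mem_univ i)
        simp only
        linarith
      have h3 : 0 ≤ ∑ i, t i * y i := Finset.sum_nonneg fun i _ => mul_nonneg (ht i) (hy i)
      have h4 := mul_le_mul_of_nonneg_left h2 hc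
      have h5 := neg_abs_le (c * g fun _ => q - N)
      simp only [hH]
      linarith [abs_nonneg (H 0)]
    -- Shrink `y` to the simplex `∑ yᵢ = N` and round up: `g` decreases and `t · y` grows by at most
    -- `∑ tᵢ`. So `H > H 0 + 1` on the simplex, and convexity along the ray from 0 gives linear
    -- growth.
    · set l := N / ∑ i, y i with hl
      have hσ0 : 0 < ∑ i, y i := hN0.trans h
      have hl0 : 0 < l := by positivity
      have hl1 : l ≤ 1 := by rw [hl, div_le_one hσ0]; exact h.le
      set y' : Fin n → ℝ := l • y with hy'
      have hy'0 : 0 ≤ y' := smul_nonneg hl0.le hy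
      set k : Fin n → ℕ := fun i => ⌈y' i⌉₊ with hk
      have hyk : ∀ i, y' i ≤ k i := fun i => Nat.le_ceil _
      have hky : ∀ i, (k i : ℝ) ≤ y' i + 1 := fun i => (Nat.ceil_lt_add_one (hy'0 i)).le
      have hsum : N ≤ ∑ i, (k i : ℝ) := by
        calc N = ∑ i, y' i := by
              simp only [hy', Pi.smul_apply, smul_eq_mul, ← Finset.mul_sum, hl]
              field_simp
          _ ≤ _ := Finset.sum_le_sum fun i _ => hyk i
      have h1 := hN k hsum
      have h2 : H (fun i => (k i : ℝ)) ≤ H y' + ∑ i, t i := by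
        have h3 : g (fun i => q - k i) ≤ g (fun i => q - y' i) :=
          hg.mono (fun i => sub_le_sub_left (hyk i) q) (hneg y' hy'0)
        have h4 := mul_le_mul_of_nonneg_left h3 hc
        have h5 : ∑ i, t i * (k i : ℝ) ≤ ∑ i, t i * y' i + ∑ i, t i := by
          rw [← Finset.sum_add_distrib]
          refine Finset.sum_le_sum fun i _ => ?_
          nlinarith [ht i, hky i]
        simp only [hH]
        linarith
      have h3 : H y' ≤ H 0 + l * (H y - H 0) := by
        have h4 := hg.convex (fun _ => q) (fun i => q - y i) (fun _ => by linarith)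
          (fun i => (hneg y hy i).trans_le (by linarith)) l hl0.le hl1
        have e : ((fun _ => q) + l • ((fun i => q - y i) - fun _ => q) : Fin n → ℝ) =
            fun i => q - y' i := by
          funext i
          simp only [hy', Pi.add_apply, Pi.smul_apply, Pi.sub_apply, smul_eq_mul]
          ring
        rw [e] at h4
        have h5 := mul_le_mul_of_nonneg_left h4 hc
        have h6 : ∑ i, t i * y' i = l * ∑ i, t i * y i := by
          rw [Finset.mul_sum]
          refine Finset.sum_congr rfl fun i _ => ?_
          simp only [hy', Pi.smul_apply, smul_eq_mul]
          ring
        simp only [hH, Pi.zero_apply, sub_zero, mul_zero, Finset.sum_const_zero, add_zero]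
        rw [h6]
        linarith
      have h4 : 1 < l * (H y - H 0) := by linarith
      have h5 : (∑ i, y i) / N < H y - H 0 := by
        rw [div_lt_iff₀ hN0]
        rw [hl, div_mul_eq_mul_div, lt_div_iff₀ hσ0] at h4
        linarith
      linarith [neg_abs_le (H 0), abs_nonneg (c * g fun _ => q - N)]
  refine ⟨-q, 1 + |H 0| + |c * g fun _ => q - N| - ∑ _i : Fin n, q / N + ∑ i, t i * q, 1 / N,
    by positivity, fun x hx => ?_⟩
  have h1 := main (fun i => q - x i) fun i => by
    have := hx i
    simp only [Pi.zero_apply]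
    linarith
  simp only [hH, sub_sub_cancel] at h1
  simp only [hH]
  have e1 : ∑ i, (t i - 1 / N) * x i = ∑ i, t i * x i - (∑ i, x i) / N := by
    simp only [sub_mul, Finset.sum_sub_distrib, Finset.sum_div, one_div, inv_mul_eq_div]
  have e2 : ∑ i, t i * (q - x i) = ∑ i, t i * q - ∑ i, t i * x i := by
    simp only [mul_sub, Finset.sum_sub_distrib]
  have e3 : (∑ i, (q - x i)) / N = ∑ _i : Fin n, q / N - (∑ i, x i) / N := by
    simp only [Finset.sum_sub_distrib, sub_div, Finset.sum_div]
  rw [e2, e3] at h1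
  rw [e1]
  linarith

end Decay

/-! ### Integrability criterion for monomials. -/

section Integrability

variable {n : ℕ} {φ : (Fin n → ℂ) → EReal}

/-- The logarithmic profile `x ↦ φ (exp x₁, …, exp xₙ)`, as a real function. -/
noncomputable def logProfile {n : ℕ} (φ : (Fin n → ℂ) → EReal) (x : Fin n → ℝ) : ℝ :=
  (φ (expPoint x)).toReal

/-- `|f|² e^{-2cφ}` is Lebesgue integrable near the origin. -/
def IsL2Near {n : ℕ} (φ : (Fin n → ℂ) → EReal) (c : ℝ) (f : (Fin n → ℂ) → ℂ) : Prop :=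
  ∃ r : ℝ, 0 < r ∧
    ∫⁻ z in Metric.ball (0 : Fin n → ℂ) r, ‖f z‖ₑ ^ 2 * EReal.exp (-(2 * ((c : EReal) * φ z))) < ⊤

/-- The monomial `z ↦ ∏ zᵢ ^ aᵢ`. -/
def monomialFn {n : ℕ} (a : Fin n → ℕ) (z : Fin n → ℂ) : ℂ := ∏ i, z i ^ a i

theorem weight_eq (htoric : IsToricOn φ (unitPolydisk n))
    (hfin : ∀ x : Fin n → ℝ, (∀ i, x i < 0) → φ (expPoint x) = (logProfile φ x : EReal))
    {z : Fin n → ℂ} (hz : z ∈ unitPolydisk n) (hz0 : ∀ i, z i ≠ 0) (c : ℝ) :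
    EReal.exp (-(2 * ((c : EReal) * φ z))) =
      ENNReal.ofReal (Real.exp (-(2 * (c * logProfile φ fun i => Real.log ‖z i‖)))) := by
  have hneg : ∀ i, Real.log ‖z i‖ < 0 := fun i => Real.log_neg (norm_pos_iff.2 (hz0 i)) (hz i)
  have h : φ z = φ (expPoint fun i => Real.log ‖z i‖) := by
    refine htoric _ hz _ (expPoint_mem hneg) fun i => ?_
    rw [norm_expPoint, Real.exp_log (norm_pos_iff.2 (hz0 i))]
  rw [h, hfin _ hneg, ← EReal.exp_coe]
  norm_cast

theorem ae_forall_ne_zero (s : Set (Fin n → ℂ)) :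
    ∀ᵐ z ∂(volume : Measure (Fin n → ℂ)).restrict s, ∀ i, z i ≠ 0 := by
  refine ae_restrict_of_ae (ae_all_iff.2 fun i => ?_)
  rw [ae_iff]
  rw [volume_pi]
  simpa using Measure.pi_hyperplane (fun _ : Fin n => (volume : Measure ℂ)) i 0

theorem enorm_monomialFn_sq {a : Fin n → ℕ} {z : Fin n → ℂ} (hz0 : ∀ i, z i ≠ 0) :
    ‖monomialFn a z‖ₑ ^ 2 = ENNReal.ofReal (Real.exp (∑ i, 2 * (a i : ℝ) * Real.log ‖z i‖)) := by
  have h : ‖monomialFn a z‖ ^ 2 = Real.exp (∑ i, 2 * (a i : ℝ) * Real.log ‖z i‖) := by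
    rw [monomialFn, norm_prod, ← Finset.prod_pow, Real.exp_sum]
    refine Finset.prod_congr rfl fun i _ => ?_
    have h0 := norm_pos_iff.2 (hz0 i)
    rw [norm_pow, ← pow_mul, mul_comm (a i) 2,
      show 2 * (a i : ℝ) * Real.log ‖z i‖ = ((2 * a i : ℕ) : ℝ) * Real.log ‖z i‖ by push_cast; ring,
      Real.exp_nat_mul, Real.exp_log h0]
  rw [← ofReal_norm, ← ENNReal.ofReal_pow (norm_nonneg _), h]

theorem integrableOn_norm_rpow_ball {B r : ℝ} (hB : 0 < B) (hr : 0 < r) :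
    IntegrableOn (fun z : ℂ => ‖z‖ ^ (2 * B - 2)) (Metric.ball 0 r) := by
  rw [integrableOn_fun_norm_addHaar (μ := (volume : Measure ℂ)) (f := fun y : ℝ => y ^ (2 * B - 2)), Complex.finrank_real_complex]
  have h := (intervalIntegral.integrableOn_Ioo_rpow_iff (s := 2 * B - 1) hr).2 (by linarith)
  refine h.congr_fun (fun y hy => ?_) measurableSet_Ioo
  simp only [Nat.add_one_sub_one, pow_one, smul_eq_mul]
  rw [show 2 * B - 1 = 1 + (2 * B - 2) by ring, Real.rpow_add hy.1, Real.rpow_one]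

/-- The decay bound dominates the integrand by `e^{2A} ∏ |zᵢ|^{2B - 2}`, which is integrable in the
plane factors because `B > 0`. -/
theorem isL2Near_monomialFn_of_hasDecay (htoric : IsToricOn φ (unitPolydisk n))
    (hfin : ∀ x : Fin n → ℝ, (∀ i, x i < 0) → φ (expPoint x) = (logProfile φ x : EReal))
    {a : Fin n → ℕ} {c : ℝ} (h : HasDecay (logProfile φ) (fun i => (a i : ℝ) + 1) c) :
    IsL2Near φ c (monomialFn a) := by
  obtain ⟨R, A, B, hB, h⟩ := h
  set r : ℝ := min 1 (Real.exp (-R)) with hr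
  have hr0 : 0 < r := lt_min one_pos (Real.exp_pos _)
  refine ⟨r, hr0, ?_⟩
  have hball : Metric.ball (0 : Fin n → ℂ) r = Set.univ.pi fun _ => Metric.ball (0 : ℂ) r :=
    (ball_pi _ hr0)
  have hint : IntegrableOn (fun z : Fin n → ℂ => ∏ i, ‖z i‖ ^ (2 * B - 2))
      (Metric.ball (0 : Fin n → ℂ) r) := by
    rw [IntegrableOn, hball, volume_pi, Measure.restrict_pi_pi]
    exact Integrable.fintype_prod (f := fun _ (z : ℂ) => ‖z‖ ^ (2 * B - 2))
      fun i => integrableOn_norm_rpow_ball hB hr0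
  refine lt_of_le_of_lt ?_ (hint.const_mul (Real.exp (2 * A))).lintegral_lt_top
  refine lintegral_mono_ae ?_
  filter_upwards [ae_forall_ne_zero (Metric.ball (0 : Fin n → ℂ) r),
    ae_restrict_mem measurableSet_ball] with z hz0 hzr
  have hzi : ∀ i, ‖z i‖ < r := fun i => by
    rw [mem_ball_zero_iff, pi_norm_lt_iff hr0] at hzr
    exact hzr i
  rw [weight_eq htoric hfin (fun i => (hzi i).trans_le (min_le_left _ _)) hz0,
    enorm_monomialFn_sq hz0, ← ENNReal.ofReal_mul (Real.exp_pos _).le, ← Real.exp_add]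
  refine ENNReal.ofReal_le_ofReal ?_
  have hx := h (fun i => Real.log ‖z i‖) fun i => by
    rw [Real.log_lt_iff_lt_exp (norm_pos_iff.2 (hz0 i))]
    exact (hzi i).trans_le (min_le_right _ _)
  have hprod : ∏ i, ‖z i‖ ^ (2 * B - 2) = Real.exp (∑ i, (2 * B - 2) * Real.log ‖z i‖) := by
    rw [Real.exp_sum]
    refine Finset.prod_congr rfl fun i _ => ?_
    rw [Real.rpow_def_of_pos (norm_pos_iff.2 (hz0 i)), mul_comm]
  rw [hprod, ← Real.exp_add, Real.exp_le_exp]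
  have e : ∑ i, 2 * (a i : ℝ) * Real.log ‖z i‖ =
      2 * (∑ i, ((a i : ℝ) + 1 - B) * Real.log ‖z i‖) +
        ∑ i, (2 * B - 2) * Real.log ‖z i‖ := by
    rw [Finset.mul_sum, ← Finset.sum_add_distrib]
    exact Finset.sum_congr rfl fun i _ => by ring
  rw [e]
  linarith

theorem volume_annulus {s t : ℝ} (hs : 0 ≤ s) (hst : s ≤ t) :
    volume (Metric.ball (0 : ℂ) t \ Metric.ball (0 : ℂ) s) =
      ENNReal.ofReal (Real.pi * (t ^ 2 - s ^ 2)) := by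
  rw [measure_sdiff (Metric.ball_subset_ball hst) measurableSet_ball.nullMeasurableSet
    measure_ball_lt_top.ne, Complex.volume_ball, Complex.volume_ball,
    ← ENNReal.ofReal_pow (hs.trans hst), ← ENNReal.ofReal_pow hs,
    show (NNReal.pi : ENNReal) = ENNReal.ofReal Real.pi by
      rw [← NNReal.coe_real_pi, ENNReal.ofReal_coe_nnreal],
    ← ENNReal.ofReal_mul (by positivity), ← ENNReal.ofReal_mul (by positivity),
    ← ENNReal.ofReal_sub _ (by positivity)]
  congr 1
  ring

/-- Cut a neighbourhood of 0 into products of annuli `e^{q - kᵢ - 1} ≤ |zᵢ| < e^{q - kᵢ}`. By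
monotonicity of `g` the integral over the `k`-th piece is at least a constant times `exp (-2 (c g(q
- k) + ∑ (aᵢ + 1) kᵢ))`. A convergent sum has only finitely many terms above a threshold, which is
the lattice condition of `IsLogProfile.hasDecay_of_finite`. -/
theorem hasDecay_of_isL2Near_monomialFn (htoric : IsToricOn φ (unitPolydisk n))
    (hfin : ∀ x : Fin n → ℝ, (∀ i, x i < 0) → φ (expPoint x) = (logProfile φ x : EReal))
    {R M : ℝ} (hg : IsLogProfile (logProfile φ) R M) {a : Fin n → ℕ} {c : ℝ} (hc : 0 ≤ c)
    (h : IsL2Near φ c (monomialFn a)) :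
    HasDecay (logProfile φ) (fun i => (a i : ℝ) + 1) c := by
  obtain ⟨r, hr0, hr⟩ := h
  set g := logProfile φ with hgdef
  have hR := hg.nonneg
  set q : ℝ := min (-R) (Real.log r) - 1 with hq
  have hqR : q < -R := by have := min_le_left (-R) (Real.log r); linarith
  have hqr : Real.exp q < r := by
    rw [← Real.lt_log_iff_exp_lt hr0]
    have := min_le_right (-R) (Real.log r); linarith
  refine hg.hasDecay_of_finite (fun i => by positivity) hc hqR ?_
  set E : ℝ := c * g (fun _ => q) + ∑ i, ((a i : ℝ) + 1) + 1 with hE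
  set ann : ℕ → Set ℂ := fun j =>
    Metric.ball 0 (Real.exp (q - j)) \ Metric.ball 0 (Real.exp (q - j - 1)) with hann
  set Q : (Fin n → ℕ) → Set (Fin n → ℂ) := fun k => Set.univ.pi fun i => ann (k i) with hQ
  have hannm : ∀ j, MeasurableSet (ann j) := fun j => measurableSet_ball.diff measurableSet_ball
  have hQm : ∀ k, MeasurableSet (Q k) := fun k => MeasurableSet.univ_pi fun i => hannm _
  have hanndisj : ∀ j l : ℕ, j < l → Disjoint (ann j) (ann l) := by
    intro j l hjl
    rw [Set.disjoint_left]
    rintro w ⟨-, h1⟩ ⟨h2, -⟩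
    refine h1 (Metric.ball_subset_ball ?_ h2)
    rw [Real.exp_le_exp]
    have : (j : ℝ) + 1 ≤ l := by exact_mod_cast hjl
    linarith
  have hQd : Pairwise (Function.onFun Disjoint Q) := by
    intro k l hkl
    obtain ⟨i, hi⟩ := Function.ne_iff.1 hkl
    refine Set.disjoint_univ_pi.2 ⟨i, ?_⟩
    rcases lt_or_gt_of_ne hi with h | h
    · exact hanndisj _ _ h
    · exact (hanndisj _ _ h).symm
  have hQsub : ∀ k, Q k ⊆ Metric.ball 0 r := by
    intro k z hz
    rw [mem_ball_zero_iff, pi_norm_lt_iff hr0]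
    intro i
    have h1 := (hz i (Set.mem_univ i)).1
    rw [mem_ball_zero_iff] at h1
    refine h1.trans_le (le_trans (Real.exp_le_exp.2 ?_) hqr.le)
    have := Nat.cast_nonneg (α := ℝ) (k i)
    linarith
  set F : (Fin n → ℂ) → ENNReal := fun z =>
    ‖monomialFn a z‖ₑ ^ 2 * EReal.exp (-(2 * ((c : EReal) * φ z))) with hF
  have hsum : ∑' k, ∫⁻ z in Q k, F z ≠ ⊤ := by
    rw [← lintegral_iUnion hQm hQd]
    exact ((lintegral_mono_set (Set.iUnion_subset hQsub)).trans_lt hr).ne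
  set V : ℝ := Real.pi * (Real.exp q ^ 2 * (1 - Real.exp (-1) ^ 2)) with hV
  have hV0 : 0 < V := by
    have : Real.exp (-1) < 1 := Real.exp_lt_one_iff.2 (by norm_num)
    have h2 : Real.exp (-1) ^ 2 < 1 := pow_lt_one₀ (Real.exp_pos _).le this two_ne_zero
    have : 0 < 1 - Real.exp (-1) ^ 2 := by linarith
    positivity
  set K : ℝ := Real.exp (∑ i, 2 * (a i : ℝ) * (q - 1)) * V ^ n with hK
  have hK0 : 0 < K := by positivity
  have hvol : ∀ j : ℕ, volume (ann j) = ENNReal.ofReal (V * Real.exp (-2 * j)) := by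
    intro j
    rw [hann, volume_annulus (Real.exp_pos _).le (Real.exp_le_exp.2 (by linarith))]
    congr 1
    have e1 : Real.exp (q - j) ^ 2 = Real.exp q ^ 2 * Real.exp (-2 * j) := by
      rw [← Real.exp_nat_mul, ← Real.exp_nat_mul, ← Real.exp_add]; congr 1; push_cast; ring
    have e2 : Real.exp (q - j - 1) ^ 2 =
        Real.exp q ^ 2 * Real.exp (-1) ^ 2 * Real.exp (-2 * j) := by
      rw [← Real.exp_nat_mul, ← Real.exp_nat_mul, ← Real.exp_nat_mul, ← Real.exp_add,
        ← Real.exp_add]; congr 1; push_cast; ring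
    rw [e1, e2, hV]
    ring
  have hlow : ∀ k : Fin n → ℕ,
      ENNReal.ofReal (K * Real.exp (-2 * (c * g (fun i => q - k i) +
        ∑ i, ((a i : ℝ) + 1) * k i))) ≤ ∫⁻ z in Q k, F z := by
    intro k
    have hvolQ : volume (Q k) = ENNReal.ofReal (V ^ n * Real.exp (∑ i, -2 * (k i : ℝ))) := by
      rw [hQ, volume_pi_pi, Real.exp_sum]
      simp only [hvol]
      rw [← ENNReal.ofReal_prod_of_nonneg (fun i _ => by positivity), Finset.prod_mul_distrib]
      simp
    have hpt : ∀ᵐ z ∂(volume : Measure (Fin n → ℂ)).restrict (Q k),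
        ENNReal.ofReal (Real.exp (∑ i, 2 * (a i : ℝ) * (q - k i - 1)) *
          Real.exp (-(2 * (c * g fun i => q - k i)))) ≤ F z := by
      filter_upwards [ae_forall_ne_zero (Q k), ae_restrict_mem (hQm k)] with z hz0 hzQ
      have hup : ∀ i, Real.log ‖z i‖ < q - k i := fun i => by
        rw [Real.log_lt_iff_lt_exp (norm_pos_iff.2 (hz0 i)), ← mem_ball_zero_iff]
        exact (hzQ i (Set.mem_univ i)).1
      have hlo : ∀ i, q - k i - 1 ≤ Real.log ‖z i‖ := fun i => by
        rw [Real.le_log_iff_exp_le (norm_pos_iff.2 (hz0 i)), ← not_lt, ← mem_ball_zero_iff]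
        exact (hzQ i (Set.mem_univ i)).2
      have hkq : ∀ i, q - (k i : ℝ) < -R := fun i => by
        have := Nat.cast_nonneg (α := ℝ) (k i)
        linarith
      have hzΩ : z ∈ unitPolydisk n := fun i => by
        rw [← Real.log_neg_iff (norm_pos_iff.2 (hz0 i))]
        linarith [hup i, hkq i]
      simp only [hF]
      rw [weight_eq htoric hfin hzΩ hz0, enorm_monomialFn_sq hz0,
        ← ENNReal.ofReal_mul (Real.exp_pos _).le]
      refine ENNReal.ofReal_le_ofReal (mul_le_mul ?_ ?_ (Real.exp_pos _).le (Real.exp_pos _).le)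
      · rw [Real.exp_le_exp]
        refine Finset.sum_le_sum fun i _ => mul_le_mul_of_nonneg_left (hlo i) (by positivity)
      · rw [Real.exp_le_exp]
        have := hg.mono (x := fun i => Real.log ‖z i‖) (y := fun i => q - k i)
          (fun i => (hup i).le) hkq
        have := mul_le_mul_of_nonneg_left this hc
        linarith
    calc ENNReal.ofReal (K * Real.exp (-2 * (c * g (fun i => q - k i) +
          ∑ i, ((a i : ℝ) + 1) * k i)))
        = ENNReal.ofReal (Real.exp (∑ i, 2 * (a i : ℝ) * (q - k i - 1)) *
          Real.exp (-(2 * (c * g fun i => q - k i)))) * volume (Q k) := by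
          rw [hvolQ, ← ENNReal.ofReal_mul (by positivity)]
          congr 1
          rw [hK, mul_right_comm, mul_comm (V ^ n), ← mul_assoc]
          congr 1
          rw [← Real.exp_add, ← Real.exp_add, ← Real.exp_add]
          congr 1
          have : -2 * (c * g (fun i => q - k i) + ∑ i, ((a i : ℝ) + 1) * k i) =
            -(2 * (c * g fun i => q - k i)) + ∑ i, -2 * (((a i : ℝ) + 1) * k i) := by
              rw [mul_add, Finset.mul_sum]; ring
          rw [this, add_left_comm, add_right_comm, add_comm (-(2 * (c * g fun i => q - k i))),
            add_comm, ← Finset.sum_add_distrib, ← Finset.sum_add_distrib, add_comm]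
          congr 1
          exact Finset.sum_congr rfl fun i _ => by ring
      _ = ∫⁻ _ in Q k, ENNReal.ofReal (Real.exp (∑ i, 2 * (a i : ℝ) * (q - k i - 1)) *
          Real.exp (-(2 * (c * g fun i => q - k i)))) := (setLIntegral_const _ _).symm
      _ ≤ _ := lintegral_mono_ae hpt
  refine (ENNReal.finite_const_le_of_tsum_ne_top hsum
    (ε := ENNReal.ofReal (K * Real.exp (-2 * E))) ?_).subset fun k hk => ?_
  · simp only [ne_eq, ENNReal.ofReal_eq_zero, not_le]
    positivity
  · refine le_trans (ENNReal.ofReal_le_ofReal ?_) (hlow k)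
    refine mul_le_mul_of_nonneg_left (Real.exp_le_exp.2 ?_) hK0.le
    have : c * g (fun i => q - k i) + ∑ i, ((a i : ℝ) + 1) * k i ≤ E := hk
    linarith

end Integrability

/-! ### Monomial expansion of analytic germs. -/

section Expansion

variable {n : ℕ}

theorem norm_monomialFn_le {a : Fin n → ℕ} {z : Fin n → ℂ} {r : ℝ} (hz : ‖z‖ ≤ r) :
    ‖monomialFn a z‖ ≤ r ^ ∑ i, a i := by
  rw [monomialFn, norm_prod, ← Finset.prod_pow_eq_pow_sum]
  refine Finset.prod_le_prod (fun i _ => norm_nonneg _) fun i _ => ?_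
  rw [norm_pow]
  exact pow_le_pow_left₀ (norm_nonneg _) ((norm_le_pi_norm z i).trans hz) _

theorem monomialFn_add (a b : Fin n → ℕ) (z : Fin n → ℂ) :
    monomialFn (a + b) z = monomialFn a z * monomialFn b z := by
  simp only [monomialFn, Pi.add_apply, pow_add, Finset.prod_mul_distrib]

/-- The multidegree of a word in the letters `0, …, n - 1`. -/
def wordDegree {n : ℕ} (w : Σ k : ℕ, Fin k → Fin n) (i : Fin n) : ℕ :=
  (Finset.univ.filter fun j => w.2 j = i).card

theorem sum_wordDegree (w : Σ k : ℕ, Fin k → Fin n) : ∑ i, wordDegree w i = w.1 := by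
  simp only [wordDegree]
  rw [← Finset.card_eq_sum_card_fiberwise fun _ _ => Finset.mem_coe.2 (Finset.mem_univ _)]
  simp

theorem prod_word (w : Σ k : ℕ, Fin k → Fin n) (z : Fin n → ℂ) :
    ∏ j, z (w.2 j) = monomialFn (wordDegree w) z := by
  rw [Finset.prod_comp z w.2, monomialFn]
  refine Finset.prod_subset (Finset.subset_univ _) fun i _ hi => ?_
  have : (Finset.univ.filter fun j => w.2 j = i) = ∅ := by
    refine Finset.filter_eq_empty_iff.2 fun j _ h => hi ?_
    exact Finset.mem_image.2 ⟨j, Finset.mem_univ _, h⟩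
  rw [this, Finset.card_empty, pow_zero]

/-- An analytic germ at the origin of `ℂⁿ` is an absolutely convergent sum of monomials. -/
theorem AnalyticAt.exists_hasSum_monomialFn {f : (Fin n → ℂ) → ℂ} (hf : AnalyticAt ℂ f 0) :
    ∃ (C : (Fin n → ℕ) → ℂ) (r : ℝ), 0 < r ∧ Summable (fun a => ‖C a‖ * r ^ ∑ i, a i) ∧
      ∀ z, ‖z‖ ≤ r → HasSum (fun a => C a * monomialFn a z) (f z) := by
  obtain ⟨p, R, hp⟩ := hf
  obtain ⟨ρ, hρ0, hρR⟩ := ENNReal.lt_iff_exists_nnreal_btwn.1 hp.r_pos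
  rw [ENNReal.coe_pos] at hρ0
  have hρ0' : (0 : ℝ) < ρ := hρ0
  -- There are `n ^ k` words of length `k`, so `n * r ≤ ρ` is needed for summability over words; `n
  -- + 1` avoids dividing by zero when `n = 0`.
  set r : ℝ := ρ / (n + 1) with hr
  have hr0 : 0 < r := by positivity
  have hrn : n * r ≤ ρ := by
    rw [hr, mul_div_assoc', div_le_iff₀ (by positivity)]
    nlinarith
  have hrρ : r ≤ ρ := by
    rw [hr, div_le_iff₀ (by positivity)]
    nlinarith [Nat.cast_nonneg (α := ℝ) n]
  set P : (Σ k : ℕ, Fin k → Fin n) → ℂ := fun w => p w.1 fun j => Pi.single (w.2 j) 1 with hP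
  have hPn : ∀ w, ‖P w‖ ≤ ‖p w.1‖ := by
    intro w
    refine ((p w.1).le_opNorm _).trans (le_of_eq ?_)
    rw [Finset.prod_eq_one fun j _ => ?_, mul_one]
    rw [Pi.norm_single, norm_one]
  have hsumP : Summable fun w : Σ k : ℕ, Fin k → Fin n => ‖P w‖ * r ^ w.1 := by
    rw [summable_sigma_of_nonneg fun w => by positivity]
    refine ⟨fun k => (hasSum_fintype _).summable, ?_⟩
    refine Summable.of_nonneg_of_le (fun k => tsum_nonneg fun w => by positivity) (fun k => ?_)
      (p.summable_norm_mul_pow (hρR.trans_le hp.r_le))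
    rw [tsum_fintype]
    calc ∑ w : Fin k → Fin n, ‖P ⟨k, w⟩‖ * r ^ k ≤ ∑ _w : Fin k → Fin n, ‖p k‖ * r ^ k := by
          refine Finset.sum_le_sum fun w _ => ?_
          gcongr
          exact hPn ⟨k, w⟩
      _ = ‖p k‖ * (n * r) ^ k := by
          simp [mul_pow]; ring
      _ ≤ ‖p k‖ * ρ ^ k := by gcongr
  have hword : ∀ z : Fin n → ℂ, ‖z‖ ≤ r →
      HasSum (fun w => P w * monomialFn (wordDegree w) z) (f z) := by
    intro z hz
    have hsum : Summable fun w => P w * monomialFn (wordDegree w) z := by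
      refine Summable.of_norm_bounded hsumP fun w => ?_
      rw [norm_mul]
      gcongr
      rw [← sum_wordDegree w]
      exact norm_monomialFn_le hz
    have hz' : z ∈ Metric.eball (0 : Fin n → ℂ) R := by
      rw [mem_eball_zero_iff]
      refine lt_of_le_of_lt ?_ hρR
      rw [enorm_eq_nnnorm, ENNReal.coe_le_coe]
      exact hz.trans hrρ
    have h := hp.hasSum hz'
    rw [zero_add] at h
    refine HasSum.sigma_of_hasSum h (fun k => ?_) hsum
    have hexp : (p k fun _ => z) =
        ∑ w : Fin k → Fin n, P ⟨k, w⟩ * monomialFn (wordDegree ⟨k, w⟩) z := by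
      have hz1 : z = ∑ i, z i • (Pi.single i 1 : Fin n → ℂ) := by
        funext i
        simp [Finset.sum_apply, Pi.single_apply]
      conv_lhs => rw [hz1]
      rw [ContinuousMultilinearMap.map_sum]
      refine Finset.sum_congr rfl fun w _ => ?_
      rw [ContinuousMultilinearMap.map_smul_univ, ← prod_word ⟨k, w⟩ z, smul_eq_mul, mul_comm]
    rw [hexp]
    exact hasSum_fintype _
  -- Regroup the sum over words by multidegree; absolute convergence permits it.
  set e := Equiv.sigmaFiberEquiv (wordDegree (n := n)) with he
  have hfib : Summable fun x : Σ a, {w // wordDegree (n := n) w = a} =>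
      ‖P x.2.1‖ * r ^ (∑ i, x.1 i) := by
    refine (e.summable_iff.2 hsumP).congr ?_
    rintro ⟨a, w, rfl⟩
    simp [he, sum_wordDegree, Equiv.sigmaFiberEquiv]
  have hfibP : ∀ a, Summable fun w : {w // wordDegree (n := n) w = a} => ‖P w.1‖ := by
    intro a
    have h1 := (hfib.sigma_factor a).mul_right (r ^ (∑ i, a i))⁻¹
    refine h1.congr fun w => ?_
    have : r ^ (∑ i, a i) ≠ 0 := (pow_pos hr0 _).ne'
    field_simp
  refine ⟨fun a => ∑' w : {w // wordDegree (n := n) w = a}, P w.1, r, hr0, ?_, fun z hz => ?_⟩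
  · refine Summable.of_nonneg_of_le (fun a => by positivity) (fun a => ?_) hfib.sigma
    simp only
    rw [tsum_mul_right]
    gcongr
    exact norm_tsum_le_tsum_norm (hfibP a)
  · refine (e.hasSum_iff.2 (hword z hz)).sigma fun a => ?_
    have hfun : (fun w : {w // wordDegree (n := n) w = a} =>
        ((fun w => P w * monomialFn (wordDegree w) z) ∘ e) ⟨a, w⟩) =
        fun w => P w.1 * monomialFn a z := by
      funext ⟨w, hw⟩
      subst hw
      rfl
    rw [hfun]
    exact (hfibP a).of_norm.hasSum.mul_right (monomialFn a z)

end Expansion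

/-! ### Extracting a monomial by averaging over roots of unity. -/

section Averaging

variable {n : ℕ}

theorem sum_root_pow_eq_zero {N : ℕ} {ζ : ℂ} (hζ : IsPrimitiveRoot ζ N) {a b : ℕ} (hba : b < a)
    (haN : a < N) : ∑ j : Fin N, ((ζ⁻¹) ^ (j : ℕ)) ^ a * (ζ ^ (j : ℕ)) ^ b = 0 := by
  have hζ0 : ζ ≠ 0 := hζ.ne_zero (by omega)
  obtain ⟨k, rfl⟩ := Nat.exists_eq_add_of_lt hba
  have hk : ∀ j : ℕ, ((ζ⁻¹) ^ j) ^ (b + k + 1) * (ζ ^ j) ^ b = ((ζ⁻¹) ^ (k + 1)) ^ j := by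
    intro j
    rw [add_assoc, pow_add, mul_right_comm, ← mul_pow, ← mul_pow, inv_mul_cancel₀ hζ0, one_pow,
      one_pow, one_mul, ← pow_mul, ← pow_mul, mul_comm]
  simp only [hk]
  rw [Fin.sum_univ_eq_sum_range (fun j => ((ζ⁻¹) ^ (k + 1)) ^ j)]
  have hne : (ζ⁻¹) ^ (k + 1) ≠ 1 := hζ.inv.pow_ne_one_of_pos_of_lt (by omega) (by omega)
  have h := mul_neg_geom_sum ((ζ⁻¹) ^ (k + 1)) N
  rw [← pow_mul, mul_comm (k + 1), pow_mul, hζ.inv.pow_eq_one, one_pow, sub_self] at h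
  exact (mul_eq_zero.1 h).resolve_left (sub_ne_zero.2 hne.symm)

theorem monomialFn_mul (a : Fin n → ℕ) (u z : Fin n → ℂ) :
    monomialFn a (fun i => u i * z i) = monomialFn a u * monomialFn a z := by
  simp only [monomialFn, mul_pow, Finset.prod_mul_distrib]

/-- A monomial occurring in the expansion of `f` is dominated near the origin by finitely many
rotates of `f`. -/
theorem norm_monomialFn_le_sum_rotate {f : (Fin n → ℂ) → ℂ} {C : (Fin n → ℕ) → ℂ} {r : ℝ}
    (hr : 0 < r) (hC : Summable fun a => ‖C a‖ * r ^ ∑ i, a i)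
    (hf : ∀ z, ‖z‖ ≤ r → HasSum (fun a => C a * monomialFn a z) (f z)) {a : Fin n → ℕ}
    (ha : C a ≠ 0) :
    ∃ (N : ℕ) (u : (Fin n → Fin N) → Fin n → Circle) (s K : ℝ), 0 < s ∧ 0 ≤ K ∧
      ∀ z : Fin n → ℂ, ‖z‖ < s →
        ‖monomialFn a z‖ ≤ K * ∑ ω, ‖f fun i => (u ω i : ℂ) * z i‖ := by
  -- Larger than every `aᵢ`, so that the average kills each monomial `b` with some `bᵢ < aᵢ`.
  -- Survivors other than `a` are proper multiples of `z^a`, hence small relative to it near 0.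
  set N : ℕ := ∑ i, a i + 1 with hN
  have haN : ∀ i, a i < N := fun i => by
    have := Finset.single_le_sum (f := a) (fun _ _ => Nat.zero_le _) (Finset.mem_univ i)
    omega
  have hN0 : N ≠ 0 := by omega
  set η : Circle := Circle.exp (2 * Real.pi / N) with hη
  have hprim : IsPrimitiveRoot (η : ℂ) N := by
    have h := Complex.isPrimitiveRoot_exp N hN0
    rw [hη, Circle.coe_exp]
    convert h using 2
    push_cast
    ring
  set ζ : ℂ := (η : ℂ) with hζ
  have hζ0 : ζ ≠ 0 := hprim.ne_zero hN0
  have hζn : ‖ζ‖ = 1 := Circle.norm_coe η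
  set u : (Fin n → Fin N) → Fin n → Circle := fun ω i => η ^ (ω i : ℕ) with hu
  set d : (Fin n → Fin N) → ℂ := fun ω => ∏ i, ((ζ⁻¹) ^ (ω i : ℕ)) ^ a i with hd
  have hdn : ∀ ω, ‖d ω‖ = 1 := fun ω => by
    simp [hd, norm_prod, hζn]
  set ε : (Fin n → ℕ) → ℂ := fun b => ∑ ω, d ω * monomialFn b fun i => (u ω i : ℂ) with hε
  set T : ℝ := (Fintype.card (Fin n → Fin N) : ℝ) with hT
  have hT0 : 0 < T := by
    have : Nonempty (Fin n → Fin N) := ⟨fun _ => ⟨0, by omega⟩⟩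
    exact Nat.cast_pos.2 Fintype.card_pos
  have hεn : ∀ b, ‖ε b‖ ≤ T := by
    intro b
    refine (norm_sum_le _ _).trans ?_
    refine (Finset.sum_le_card_nsmul _ _ 1 fun ω _ => ?_).trans (by simp [hT])
    rw [norm_mul, hdn, one_mul, monomialFn, norm_prod]
    exact le_of_eq (Finset.prod_eq_one fun i _ => by rw [norm_pow, Circle.norm_coe, one_pow])
  have hεprod : ∀ b, ε b = ∏ i, ∑ j : Fin N, ((ζ⁻¹) ^ (j : ℕ)) ^ a i * (ζ ^ (j : ℕ)) ^ b i := by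
    intro b
    rw [Finset.prod_univ_sum, Fintype.piFinset_univ]
    refine Finset.sum_congr rfl fun ω _ => ?_
    simp only [hd, monomialFn, hu, Circle.coe_pow, Finset.prod_mul_distrib]
    rfl
  have hεa : ε a = T := by
    have : ∀ ω, d ω * monomialFn a (fun i => (u ω i : ℂ)) = 1 := by
      intro ω
      simp only [hd, monomialFn, hu, Circle.coe_pow, ← Finset.prod_mul_distrib]
      refine Finset.prod_eq_one fun i _ => ?_
      rw [← mul_pow, ← mul_pow, inv_mul_cancel₀ hζ0, one_pow, one_pow]
    simp only [hε, this]
    simp [hT]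
  have hε0 : ∀ b, ¬ a ≤ b → ε b = 0 := by
    intro b hb
    rw [Pi.le_def, not_forall] at hb
    obtain ⟨i, hi⟩ := hb
    rw [hεprod]
    exact Finset.prod_eq_zero (Finset.mem_univ i)
      (sum_root_pow_eq_zero hprim (not_le.1 hi) (haN i))
  set S : ℝ := ∑' b, ‖C b‖ * r ^ ∑ i, b i with hS
  have hS0 : 0 ≤ S := tsum_nonneg fun b => by positivity
  have hCa : 0 < ‖C a‖ := norm_pos_iff.2 ha
  set ρ : ℝ := (r ^ (∑ i, a i) * r)⁻¹ with hρ
  have hρ0 : 0 < ρ := by positivity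
  -- For `‖z‖ < s` the other survivors contribute at most half of the `z^a` term.
  set s : ℝ := min r (‖C a‖ / (2 * (ρ * S + 1))) with hs
  have hs0 : 0 < s := lt_min hr (by positivity)
  refine ⟨N, u, s, 2 / (T * ‖C a‖), hs0, by positivity, fun z hz => ?_⟩
  have hzr : ‖z‖ ≤ r := (hz.trans_le (min_le_left _ _)).le
  have hrot : ∀ ω, ‖fun i => (u ω i : ℂ) * z i‖ ≤ r := by
    intro ω
    rw [pi_norm_le_iff_of_nonneg hr.le]
    intro i
    rw [norm_mul, Circle.norm_coe, one_mul]
    exact (norm_le_pi_norm z i).trans hzr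
  have hsum : HasSum (fun b => ε b * (C b * monomialFn b z))
      (∑ ω, d ω * f fun i => (u ω i : ℂ) * z i) := by
    have h := hasSum_sum (s := Finset.univ) fun ω (_ : ω ∈ Finset.univ) =>
      (hf _ (hrot ω)).mul_left (d ω)
    refine h.congr_fun fun b => ?_
    simp only [hε, Finset.sum_mul, monomialFn_mul]
    exact Finset.sum_congr rfl fun ω _ => by ring
  set A := ∑ ω, d ω * f fun i => (u ω i : ℂ) * z i with hA
  have hrest : ‖A - ε a * (C a * monomialFn a z)‖ ≤ T * ‖monomialFn a z‖ * ‖z‖ * ρ * S := by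
    have h1 := hasSum_ite_sub_hasSum hsum a
    rw [← h1.tsum_eq]
    refine tsum_of_norm_bounded (hC.hasSum.mul_left (T * ‖monomialFn a z‖ * ‖z‖ * ρ)) fun b => ?_
    split_ifs with hba
    · rw [norm_zero]; positivity
    by_cases hab : a ≤ b
    · obtain ⟨c, rfl⟩ := exists_add_of_le hab
      have hc0 : c ≠ 0 := by
        rintro rfl
        exact hba (add_zero a)
      obtain ⟨m, hm⟩ : ∃ m, ∑ i, c i = m + 1 := by
        refine Nat.exists_eq_succ_of_ne_zero fun h => hc0 ?_
        funext i
        exact (Finset.sum_eq_zero_iff.1 h) i (Finset.mem_univ i)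
      have hmc : ‖monomialFn c z‖ ≤ ‖z‖ * r ^ m := by
        refine (norm_monomialFn_le le_rfl).trans ?_
        rw [hm, pow_succ, mul_comm]
        gcongr
      have hdeg : r ^ (∑ i, (a + c) i) = r ^ m * ρ⁻¹ := by
        simp only [Pi.add_apply, Finset.sum_add_distrib, hm, hρ, inv_inv]
        ring
      rw [hdeg, norm_mul, norm_mul, monomialFn_add, norm_mul]
      calc ‖ε (a + c)‖ * (‖C (a + c)‖ * (‖monomialFn a z‖ * ‖monomialFn c z‖))
          ≤ T * (‖C (a + c)‖ * (‖monomialFn a z‖ * (‖z‖ * r ^ m))) := by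
            gcongr
            exact hεn _
        _ = _ := by field_simp
    · rw [hε0 b hab, zero_mul, norm_zero]; positivity
  have hzs : ‖z‖ * ρ * S ≤ ‖C a‖ / 2 := by
    have h1 := (hz.trans_le (min_le_right _ _)).le
    rw [le_div_iff₀ (by positivity)] at h1
    nlinarith [norm_nonneg z]
  have hmain : T * ‖C a‖ * ‖monomialFn a z‖ ≤ 2 * ‖A‖ := by
    have h1 : ‖ε a * (C a * monomialFn a z)‖ = T * ‖C a‖ * ‖monomialFn a z‖ := by
      rw [norm_mul, norm_mul, hεa, Complex.norm_real, Real.norm_eq_abs, abs_of_pos hT0, mul_assoc]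
    have h2 := norm_sub_norm_le (ε a * (C a * monomialFn a z)) A
    rw [norm_sub_rev, h1] at h2
    have h3 : T * ‖monomialFn a z‖ * ‖z‖ * ρ * S ≤ T * ‖monomialFn a z‖ * (‖C a‖ / 2) := by
      have := mul_le_mul_of_nonneg_left hzs (by positivity : 0 ≤ T * ‖monomialFn a z‖)
      linarith
    linarith
  have hAle : ‖A‖ ≤ ∑ ω, ‖f fun i => (u ω i : ℂ) * z i‖ := by
    refine (norm_sum_le _ _).trans (Finset.sum_le_sum fun ω _ => ?_)
    rw [norm_mul, hdn, one_mul]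
  rw [div_mul_eq_mul_div, le_div_iff₀ (by positivity)]
  linarith

end Averaging

/-! ### Dickson's lemma and domination by finitely many monomials. -/

section Dominated

variable {n : ℕ} {φ : (Fin n → ℂ) → EReal}

/-- Dickson's lemma: the minimal elements of `S` form an antichain in the well-quasi-order `ℕⁿ`,
hence a finite set. -/
theorem exists_finset_le (S : Set (Fin n → ℕ)) :
    ∃ F : Finset (Fin n → ℕ), (∀ b ∈ F, b ∈ S) ∧ ∀ a ∈ S, ∃ b ∈ F, b ≤ a := by
  have hS : S.IsPWO := Set.isPWO_of_wellQuasiOrderedLE S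
  have hfin : {a | Minimal (· ∈ S) a}.Finite :=
    IsAntichain.finite_of_partiallyWellOrderedOn (setOfPred_minimal_antichain _)
      (hS.mono fun a ha => ha.prop)
  refine ⟨hfin.toFinset, fun b hb => ((hfin.mem_toFinset).1 hb).prop, fun a ha => ?_⟩
  obtain ⟨b, hb, hmin⟩ := hS.exists_le_minimal ha
  exact ⟨b, (hfin.mem_toFinset).2 hmin, hb⟩

/-- A convergent power series is dominated by the minimal monomials of its support. -/
theorem norm_le_sum_monomialFn {f : (Fin n → ℂ) → ℂ} {C : (Fin n → ℕ) → ℂ} {r : ℝ}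
    (hr : 0 < r) (hC : Summable fun a => ‖C a‖ * r ^ ∑ i, a i)
    (hf : ∀ z, ‖z‖ ≤ r → HasSum (fun a => C a * monomialFn a z) (f z))
    {F : Finset (Fin n → ℕ)} (hF : ∀ a, C a ≠ 0 → ∃ b ∈ F, b ≤ a) :
    ∃ K : ℝ, 0 ≤ K ∧ ∀ z, ‖z‖ ≤ r → ‖f z‖ ≤ K * ∑ b ∈ F, ‖monomialFn b z‖ := by
  set S : ℝ := ∑' b, ‖C b‖ * r ^ ∑ i, b i with hS
  have hS0 : 0 ≤ S := tsum_nonneg fun b => by positivity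
  set L : ℝ := ∑ b ∈ F, (r ^ ∑ i, b i)⁻¹ with hL
  have hL0 : 0 ≤ L := Finset.sum_nonneg fun b _ => by positivity
  refine ⟨L * S, by positivity, fun z hz => ?_⟩
  set G : ℝ := ∑ b ∈ F, ‖monomialFn b z‖ with hG
  have hG0 : 0 ≤ G := Finset.sum_nonneg fun b _ => norm_nonneg _
  rw [mul_right_comm, ← (hf z hz).tsum_eq]
  refine tsum_of_norm_bounded (hC.hasSum.mul_left (L * G)) fun a => ?_
  rw [norm_mul]
  by_cases ha : C a = 0
  · simp [ha]
  · obtain ⟨b, hbF, hba⟩ := hF a ha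
    obtain ⟨c, rfl⟩ := exists_add_of_le hba
    rw [monomialFn_add, norm_mul]
    have h1 : ‖monomialFn b z‖ ≤ G :=
      Finset.single_le_sum (f := fun b => ‖monomialFn b z‖) (fun _ _ => norm_nonneg _) hbF
    have h2 : (r ^ ∑ i, b i)⁻¹ ≤ L :=
      Finset.single_le_sum (f := fun b : Fin n → ℕ => (r ^ ∑ i, b i)⁻¹)
        (fun _ _ => by positivity) hbF
    have h3 : r ^ (∑ i, c i) = (r ^ ∑ i, b i)⁻¹ * r ^ (∑ i, (b + c) i) := by
      simp only [Pi.add_apply, Finset.sum_add_distrib, pow_add]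
      field_simp
    calc ‖C (b + c)‖ * (‖monomialFn b z‖ * ‖monomialFn c z‖)
        ≤ ‖C (b + c)‖ * (G * r ^ (∑ i, c i)) := by
          gcongr
          exact norm_monomialFn_le hz
      _ = (r ^ ∑ i, b i)⁻¹ * G * (‖C (b + c)‖ * r ^ (∑ i, (b + c) i)) := by rw [h3]; ring
      _ ≤ L * G * (‖C (b + c)‖ * r ^ (∑ i, (b + c) i)) := by gcongr

/-- `L²` domination by finitely many functions. -/
theorem lintegral_lt_top_of_norm_le_sum {α ι : Type*} [MeasurableSpace α] {μ : Measure α}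
    {s : Finset ι} {h : ι → α → ℂ} {f : α → ℂ} {W : α → ENNReal} {U : Set α}
    (hU : MeasurableSet U) {K : ℝ} (hle : ∀ z ∈ U, ‖f z‖ ≤ K * ∑ b ∈ s, ‖h b z‖)
    (hmeas : ∀ b ∈ s, AEMeasurable (fun z => ‖h b z‖ₑ ^ 2 * W z) (μ.restrict U))
    (hfin : ∀ b ∈ s, ∫⁻ z in U, ‖h b z‖ₑ ^ 2 * W z ∂μ < ⊤) :
    ∫⁻ z in U, ‖f z‖ₑ ^ 2 * W z ∂μ < ⊤ := by
  have hpt : ∀ z ∈ U, ‖f z‖ₑ ^ 2 ≤ ENNReal.ofReal (K ^ 2 * s.card) * ∑ b ∈ s, ‖h b z‖ₑ ^ 2 := by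
    intro z hz
    have h1 : ‖f z‖ ^ 2 ≤ K ^ 2 * s.card * ∑ b ∈ s, ‖h b z‖ ^ 2 := by
      calc ‖f z‖ ^ 2 ≤ (K * ∑ b ∈ s, ‖h b z‖) ^ 2 := by gcongr; exact hle z hz
        _ = K ^ 2 * (∑ b ∈ s, ‖h b z‖) ^ 2 := by ring
        _ ≤ K ^ 2 * (s.card * ∑ b ∈ s, ‖h b z‖ ^ 2) := by
            gcongr
            exact sq_sum_le_card_mul_sum_sq
        _ = _ := by ring
    have h2 := ENNReal.ofReal_le_ofReal h1
    rw [ENNReal.ofReal_mul (by positivity), ENNReal.ofReal_pow (norm_nonneg _),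
      ENNReal.ofReal_sum_of_nonneg fun b _ => by positivity] at h2
    simpa only [ENNReal.ofReal_pow (norm_nonneg _), ofReal_norm] using h2
  calc ∫⁻ z in U, ‖f z‖ₑ ^ 2 * W z ∂μ
      ≤ ∫⁻ z in U, ENNReal.ofReal (K ^ 2 * s.card) * ∑ b ∈ s, ‖h b z‖ₑ ^ 2 * W z ∂μ := by
        refine setLIntegral_mono_ae' hU (Filter.Eventually.of_forall fun z hz => ?_)
        rw [← Finset.sum_mul, ← mul_assoc]
        gcongr
        exact hpt z hz
    _ = ENNReal.ofReal (K ^ 2 * s.card) * ∑ b ∈ s, ∫⁻ z in U, ‖h b z‖ₑ ^ 2 * W z ∂μ := by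
        rw [lintegral_const_mul' _ _ ENNReal.ofReal_ne_top, lintegral_finsetSum' _ hmeas]
    _ < ⊤ := ENNReal.mul_lt_top ENNReal.ofReal_lt_top (ENNReal.sum_lt_top.2 hfin)

end Dominated

/-! ### Multiplier ideals of toric weights are monomial. -/

section Membership

variable {n : ℕ} {φ : (Fin n → ℂ) → EReal}

theorem IsPlurisubharmonicOn.aemeasurable (hφ : IsPlurisubharmonicOn φ (unitPolydisk n)) :
    AEMeasurable φ (volume.restrict (unitPolydisk n)) := by
  classical
  have ho := isOpen_unitPolydisk n
  refine ⟨(unitPolydisk n).piecewise φ fun _ => ⊥, measurable_of_Iio fun c => ?_, ?_⟩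
  · have h1 : IsOpen (unitPolydisk n ∩ {z | φ z < c}) := by
      rw [isOpen_iff_mem_nhds]
      rintro z ⟨hz, hzc⟩
      have := hφ.upperSemicontinuousOn z hz c hzc
      rw [ho.nhdsWithin_eq hz] at this
      exact Filter.inter_mem (ho.mem_nhds hz) this
    rw [Set.piecewise_preimage, Set.ite]
    refine MeasurableSet.union ?_ (MeasurableSet.diff ?_ ho.measurableSet)
    · rw [Set.inter_comm]
      exact h1.measurableSet
    · exact measurable_const measurableSet_Iio
  · filter_upwards [ae_restrict_mem ho.measurableSet] with z hz
    rw [Set.piecewise_eq_of_mem _ _ _ hz]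

theorem antitone_exp_neg_mul {c : ℝ} (hc : 0 ≤ c) :
    Antitone fun x : EReal => EReal.exp (-(2 * ((c : EReal) * x))) := by
  intro x y hxy
  refine EReal.exp_monotone (EReal.neg_le_neg_iff.2 ?_)
  have hc' : (0 : EReal) ≤ c := by exact_mod_cast hc
  gcongr

theorem aemeasurable_weight (hφ : IsPlurisubharmonicOn φ (unitPolydisk n)) {c : ℝ} (hc : 0 ≤ c)
    {r : ℝ} (hr : r ≤ 1) : AEMeasurable (fun z => EReal.exp (-(2 * ((c : EReal) * φ z))))
      (volume.restrict (Metric.ball (0 : Fin n → ℂ) r)) := by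
  refine ((antitone_exp_neg_mul hc).measurable.comp_aemeasurable hφ.aemeasurable).mono_measure ?_
  rw [unitPolydisk_eq_ball]
  exact Measure.restrict_mono (Metric.ball_subset_ball hr) le_rfl

theorem aemeasurable_enorm_sq {f : (Fin n → ℂ) → ℂ} {r : ℝ}
    (hf : ContinuousOn f (Metric.ball 0 r)) :
    AEMeasurable (fun z => ‖f z‖ₑ ^ 2) (volume.restrict (Metric.ball (0 : Fin n → ℂ) r)) :=
  ((hf.aestronglyMeasurable measurableSet_ball).enorm).pow_const 2

theorem isL2Near_iff_eventually {c : ℝ} {f : (Fin n → ℂ) → ℂ} :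
    IsL2Near φ c f ↔ ∀ᶠ r in 𝓝[>] (0 : ℝ), ∫⁻ z in Metric.ball (0 : Fin n → ℂ) r,
      ‖f z‖ₑ ^ 2 * EReal.exp (-(2 * ((c : EReal) * φ z))) < ⊤ := by
  constructor
  · rintro ⟨r, hr, h⟩
    filter_upwards [Ioo_mem_nhdsGT hr] with s hs
    exact (lintegral_mono_set (Metric.ball_subset_ball hs.2.le)).trans_lt h
  · intro h
    obtain ⟨r, h1, h2⟩ := (h.and self_mem_nhdsWithin).exists
    exact ⟨r, h2, h1⟩

theorem eventually_continuousOn_ball {f : (Fin n → ℂ) → ℂ} (hf : AnalyticAt ℂ f 0) :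
    ∀ᶠ r in 𝓝[>] (0 : ℝ), ContinuousOn f (Metric.ball 0 r) := by
  obtain ⟨r, hr, h⟩ := Metric.eventually_nhds_iff_ball.1 hf.eventually_analyticAt
  filter_upwards [Ioo_mem_nhdsGT hr] with s hs z hz
  exact (h z (Metric.ball_subset_ball hs.2.le hz)).continuousAt.continuousWithinAt

theorem memLp_weightMeasure_iff (hφ : IsPlurisubharmonicOn φ (unitPolydisk n)) {c : ℝ}
    (hc : 0 ≤ c) {r : ℝ} (hr : r ≤ 1) {f : (Fin n → ℂ) → ℂ}
    (hf : ContinuousOn f (Metric.ball 0 r)) :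
    MemLp f 2 ((weightMeasure fun z => (c : EReal) * φ z).restrict (Metric.ball 0 r)) ↔
      ∫⁻ z in Metric.ball (0 : Fin n → ℂ) r,
        ‖f z‖ₑ ^ 2 * EReal.exp (-(2 * ((c : EReal) * φ z))) < ⊤ := by
  have hW := aemeasurable_weight hφ hc hr
  have hae : AEStronglyMeasurable f
      ((weightMeasure fun z => (c : EReal) * φ z).restrict (Metric.ball 0 r)) :=
    hf.aestronglyMeasurable measurableSet_ball
  rw [MemLp, and_iff_right hae,
    eLpNorm_lt_top_iff_lintegral_rpow_enorm_lt_top two_ne_zero ENNReal.ofNat_ne_top]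
  rw [weightMeasure, restrict_withDensity measurableSet_ball]
  simp only [ENNReal.toReal_ofNat, ENNReal.rpow_ofNat]
  rw [lintegral_withDensity_eq_lintegral_mul₀ hW (aemeasurable_enorm_sq hf)]
  simp only [Pi.mul_apply, mul_comm]

/-- Membership in the multiplier ideal, for a germ with a given analytic representative. -/
theorem mem_multiplierIdeal_iff (hφ : IsPlurisubharmonicOn φ (unitPolydisk n)) {c : ℝ}
    (hc : 0 ≤ c) {f : (Fin n → ℂ) → ℂ} (hf : AnalyticAt ℂ f 0) :
    (⟨(f : Filter.Germ (𝓝 (0 : Fin n → ℂ)) ℂ), f, hf, rfl⟩ : HolomorphicGerm (0 : Fin n → ℂ)) ∈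
      multiplierIdeal (fun z => (c : EReal) * φ z) 0 ↔ IsL2Near φ c f := by
  have h1 : ∀ᶠ r in 𝓝[>] (0 : ℝ), r ≤ 1 :=
    (Filter.Eventually.filter_mono nhdsWithin_le_nhds (ge_mem_nhds one_pos))
  constructor
  · rintro ⟨f', hff', U, hU, hLp⟩
    obtain ⟨ρ, hρ, hρU⟩ := Metric.mem_nhds_iff.1 (Filter.inter_mem hU (Filter.Germ.coe_eq.1 hff'))
    rw [isL2Near_iff_eventually]
    filter_upwards [eventually_continuousOn_ball hf, h1, Ioo_mem_nhdsGT hρ] with r hr1 hr2 hr3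
    have hsub : Metric.ball (0 : Fin n → ℂ) r ⊆ U ∩ {z | f' z = f z} :=
      (Metric.ball_subset_ball hr3.2.le).trans hρU
    rw [← memLp_weightMeasure_iff hφ hc hr2 hr1]
    refine (memLp_congr_ae ?_).1 (hLp.mono_measure
      (Measure.restrict_mono (hsub.trans Set.inter_subset_left) le_rfl))
    filter_upwards [ae_restrict_mem measurableSet_ball] with z hz
    exact (hsub hz).2
  · intro h
    obtain ⟨r, ⟨⟨hr1, hr2⟩, hr3⟩, hr0⟩ :=
      (((isL2Near_iff_eventually.1 h).and (eventually_continuousOn_ball hf)).and h1 |>.and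
        self_mem_nhdsWithin).exists
    exact ⟨f, rfl, _, Metric.ball_mem_nhds _ hr0,
      (memLp_weightMeasure_iff hφ hc hr3 hr2).2 hr1⟩

theorem measurePreserving_rotate (u : Fin n → Circle) :
    MeasurePreserving (fun (z : Fin n → ℂ) i => (u i : ℂ) * z i) := by
  refine volume_preserving_pi (f := fun i (w : ℂ) => (u i : ℂ) * w) fun i => ?_
  exact (rotation (u i)).measurePreserving

theorem setLIntegral_rotate (htoric : IsToricOn φ (unitPolydisk n)) (u : Fin n → Circle) (c : ℝ)
    {r : ℝ} (hr : r ≤ 1) (f : (Fin n → ℂ) → ℂ) :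
    ∫⁻ z in Metric.ball (0 : Fin n → ℂ) r,
        ‖f fun i => (u i : ℂ) * z i‖ₑ ^ 2 * EReal.exp (-(2 * ((c : EReal) * φ z))) =
      ∫⁻ z in Metric.ball (0 : Fin n → ℂ) r,
        ‖f z‖ₑ ^ 2 * EReal.exp (-(2 * ((c : EReal) * φ z))) := by
  have hinj : Function.Injective fun (z : Fin n → ℂ) i => (u i : ℂ) * z i := by
    intro z w hzw
    funext i
    exact mul_left_cancel₀ (Circle.coe_ne_zero (u i)) (congrFun hzw i)
  have hemb : MeasurableEmbedding fun (z : Fin n → ℂ) i => (u i : ℂ) * z i :=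
    (Continuous.measurableEmbedding (by fun_prop) hinj)
  have hnorm : ∀ (z : Fin n → ℂ) i, ‖(u i : ℂ) * z i‖ = ‖z i‖ := fun z i => by
    rw [norm_mul, Circle.norm_coe, one_mul]
  have hpre : (fun (z : Fin n → ℂ) i => (u i : ℂ) * z i) ⁻¹' Metric.ball 0 r =
      Metric.ball 0 r := by
    ext z
    have : ‖fun i => (u i : ℂ) * z i‖ = ‖z‖ := by
      simp only [Pi.norm_def]
      congr 2
      funext i
      exact NNReal.eq (hnorm z i)
    simp [this]
  rw [← (measurePreserving_rotate u).setLIntegral_comp_preimage_emb hemb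
    (fun z => ‖f z‖ₑ ^ 2 * EReal.exp (-(2 * ((c : EReal) * φ z)))) (Metric.ball 0 r), hpre]
  refine setLIntegral_congr_fun measurableSet_ball fun z hz => ?_
  have hzΩ : z ∈ unitPolydisk n := by
    rw [unitPolydisk_eq_ball]; exact Metric.ball_subset_ball hr hz
  have : φ (fun i => (u i : ℂ) * z i) = φ z :=
    htoric _ (fun i => by rw [hnorm]; exact hzΩ i) _ hzΩ (hnorm z)
  simp only [this]

/-- Multiplier ideals of toric weights are monomial: membership is tested on the monomials of the
power series expansion. -/
theorem isL2Near_iff_forall_monomialFn (hφ : IsPlurisubharmonicOn φ (unitPolydisk n))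
    (htoric : IsToricOn φ (unitPolydisk n)) {c : ℝ} (hc : 0 ≤ c) {f : (Fin n → ℂ) → ℂ}
    (hfan : AnalyticAt ℂ f 0) {C : (Fin n → ℕ) → ℂ} {r : ℝ}
    (hr : 0 < r) (hC : Summable fun a => ‖C a‖ * r ^ ∑ i, a i)
    (hf : ∀ z, ‖z‖ ≤ r → HasSum (fun a => C a * monomialFn a z) (f z)) :
    IsL2Near φ c f ↔ ∀ a, C a ≠ 0 → IsL2Near φ c (monomialFn a) := by
  have h1 : ∀ᶠ r in 𝓝[>] (0 : ℝ), r ≤ 1 :=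
    (Filter.Eventually.filter_mono nhdsWithin_le_nhds (ge_mem_nhds one_pos))
  constructor
  · intro h a ha
    obtain ⟨N, u, s, K, hs, -, hle⟩ := norm_monomialFn_le_sum_rotate hr hC hf ha
    rw [isL2Near_iff_eventually]
    filter_upwards [isL2Near_iff_eventually.1 h, eventually_continuousOn_ball hfan, h1,
      Ioo_mem_nhdsGT hs] with ρ hρ hρc hρ1 hρs
    refine lintegral_lt_top_of_norm_le_sum (s := Finset.univ)
      (h := fun ω z => f fun i => (u ω i : ℂ) * z i) measurableSet_ball (K := K)
      (fun z hz => hle z ((mem_ball_zero_iff.1 hz).trans hρs.2)) (fun ω _ => ?_) fun ω _ => ?_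
    · refine (aemeasurable_enorm_sq ?_).mul (aemeasurable_weight hφ hc hρ1)
      refine hρc.comp (by fun_prop) fun z hz => ?_
      rw [mem_ball_zero_iff, pi_norm_lt_iff hρs.1] at hz ⊢
      intro i
      rw [norm_mul, Circle.norm_coe, one_mul]
      exact hz i
    · rw [setLIntegral_rotate htoric (u ω) c hρ1 f]
      exact hρ
  · intro h
    obtain ⟨F, hF1, hF2⟩ := exists_finset_le {a | C a ≠ 0}
    obtain ⟨K, -, hle⟩ := norm_le_sum_monomialFn hr hC hf (F := F) hF2
    rw [isL2Near_iff_eventually]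
    filter_upwards [(Filter.eventually_all_finset F).2 fun b hb =>
      isL2Near_iff_eventually.1 (h b (hF1 b hb)), h1, Ioo_mem_nhdsGT hr] with ρ hρ hρ1 hρr
    refine lintegral_lt_top_of_norm_le_sum (s := F) (h := monomialFn) measurableSet_ball (K := K)
      (fun z hz => hle z ((mem_ball_zero_iff.1 hz).trans hρr.2).le) (fun b _ => ?_) hρ
    refine (aemeasurable_enorm_sq ?_).mul (aemeasurable_weight hφ hc hρ1)
    unfold monomialFn
    fun_prop

theorem analyticAt_monomialFn (a : Fin n → ℕ) (z : Fin n → ℂ) :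
    AnalyticAt ℂ (monomialFn a) z :=
  Finset.analyticAt_fun_prod _ fun i _ =>
    ((ContinuousLinearMap.proj (R := ℂ) (φ := fun _ : Fin n => ℂ) i).analyticAt z).pow (a i)

theorem multiplierIdeal_le_iff (hφ : IsPlurisubharmonicOn φ (unitPolydisk n))
    (htoric : IsToricOn φ (unitPolydisk n)) {c c' : ℝ} (hc : 0 ≤ c) (hc' : 0 ≤ c') :
    multiplierIdeal (fun z => (c : EReal) * φ z) 0 ≤
        multiplierIdeal (fun z => (c' : EReal) * φ z) 0 ↔
      ∀ a : Fin n → ℕ, IsL2Near φ c (monomialFn a) → IsL2Near φ c' (monomialFn a) := by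
  constructor
  · intro h a ha
    rw [← mem_multiplierIdeal_iff hφ hc' (analyticAt_monomialFn a 0)]
    exact h ((mem_multiplierIdeal_iff hφ hc (analyticAt_monomialFn a 0)).2 ha)
  · rintro h ⟨_, f, hf, rfl⟩ hmem
    rw [mem_multiplierIdeal_iff hφ hc hf] at hmem
    rw [mem_multiplierIdeal_iff hφ hc' hf]
    obtain ⟨C, r, hr, hC, hexp⟩ := hf.exists_hasSum_monomialFn
    rw [isL2Near_iff_forall_monomialFn hφ htoric hc hf hr hC hexp] at hmem
    rw [isL2Near_iff_forall_monomialFn hφ htoric hc' hf hr hC hexp]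
    exact fun a ha => h a (hmem a ha)

end Membership

/-! ### Degenerate weights, right-continuity and scaling of exponents. -/

section JumpingNumbers

variable {n : ℕ} {φ : (Fin n → ℂ) → EReal}

/-- If a toric psh function is `-∞` somewhere on the open torus, then all its multiplier ideals
coincide. -/
theorem multiplierIdeal_le_of_eq_bot (hφ : IsPlurisubharmonicOn φ (unitPolydisk n))
    (htoric : IsToricOn φ (unitPolydisk n)) {x : Fin n → ℝ} (hx : ∀ i, x i < 0)
    (hbot : φ (expPoint x) = ⊥) {c c' : ℝ} (hc : 0 < c) (hc' : 0 < c') :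
    multiplierIdeal (fun z => (c : EReal) * φ z) 0 ≤
      multiplierIdeal (fun z => (c' : EReal) * φ z) 0 := by
  rw [multiplierIdeal_le_iff hφ htoric hc.le hc'.le]
  intro a h
  rw [isL2Near_iff_eventually] at h ⊢
  filter_upwards [h, Ioo_mem_nhdsGT one_pos] with r hr hr1
  refine lt_of_le_of_lt (le_of_eq ?_) hr
  refine lintegral_congr_ae ?_
  filter_upwards [ae_forall_ne_zero (Metric.ball (0 : Fin n → ℂ) r),
    ae_restrict_mem measurableSet_ball] with z hz0 hz
  have hzΩ : z ∈ unitPolydisk n := by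
    rw [unitPolydisk_eq_ball]; exact Metric.ball_subset_ball hr1.2.le hz
  have hneg : ∀ i, Real.log ‖z i‖ < 0 := fun i => Real.log_neg (norm_pos_iff.2 (hz0 i)) (hzΩ i)
  have hz' : φ z = ⊥ := by
    rw [← eq_bot_of_eq_bot hφ htoric hx hneg hbot]
    refine htoric _ hzΩ _ (expPoint_mem hneg) fun i => ?_
    rw [norm_expPoint, Real.exp_log (norm_pos_iff.2 (hz0 i))]
  rw [hz', EReal.coe_mul_bot_of_pos hc, EReal.coe_mul_bot_of_pos hc']

/-- The upper bound near `(-∞, …, -∞)` is upper semicontinuity of `φ` at the origin. -/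
theorem exists_isLogProfile (hφ : IsPlurisubharmonicOn φ (unitPolydisk n))
    (htoric : IsToricOn φ (unitPolydisk n))
    (hfin : ∀ x : Fin n → ℝ, (∀ i, x i < 0) → φ (expPoint x) = (logProfile φ x : EReal)) :
    ∃ R M, IsLogProfile (logProfile φ) R M := by
  have h0 : (0 : Fin n → ℂ) ∈ unitPolydisk n := fun i => by simp
  obtain ⟨M, hM, -⟩ := EReal.lt_iff_exists_real_btwn.1 (hφ.lt_top 0 h0)
  have hev := hφ.upperSemicontinuousOn 0 h0 M hM
  rw [(isOpen_unitPolydisk n).nhdsWithin_eq h0, Metric.eventually_nhds_iff_ball] at hev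
  obtain ⟨r, hr, hrM⟩ := hev
  refine ⟨max 0 (-Real.log r), M, le_max_left _ _, fun x y hx hy t ht0 ht1 => ?_, fun x hx => ?_⟩
  · have h := logConvex_of_toric hφ htoric hx hy ht0 ht1 (hfin x hx).le (hfin y hy).le
    rw [hfin _ fun i => ?_, EReal.coe_le_coe_iff] at h
    · exact h
    · have e : (x + t • (y - x)) i = (1 - t) * x i + t * y i := by
        simp only [Pi.add_apply, Pi.smul_apply, Pi.sub_apply, smul_eq_mul]; ring
      rw [e]
      rcases ht0.eq_or_lt with rfl | h
      · simpa using hx i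
      · nlinarith [mul_neg_of_pos_of_neg h (hy i), hx i]
  · have hx0 : ∀ i, x i < 0 := fun i =>
      (hx i).trans_le (neg_nonpos.2 (le_max_left _ _))
    have h : expPoint x ∈ Metric.ball (0 : Fin n → ℂ) r := by
      rw [mem_ball_zero_iff, pi_norm_lt_iff hr]
      intro i
      rw [norm_expPoint, ← Real.lt_log_iff_exp_lt hr]
      have := le_max_right 0 (-Real.log r)
      linarith [hx i]
    have : φ (expPoint x) < (M : EReal) := hrM _ h
    rw [hfin x hx0, EReal.coe_lt_coe_iff] at this
    exact this.le

/-- Right-continuity of the ideals: by Dickson's lemma finitely many exponents control all others,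
so one `ε` serves them all. -/
theorem exists_gt_forall_hasDecay {g : (Fin n → ℝ) → ℝ} {R M : ℝ} (hg : IsLogProfile g R M)
    {c : ℝ} (hc : 0 < c) : ∃ ε > 0, ∀ a : Fin n → ℕ, HasDecay g (fun i => (a i : ℝ) + 1) c →
      HasDecay g (fun i => (a i : ℝ) + 1) (c + ε) := by
  obtain ⟨F, hF1, hF2⟩ := exists_finset_le {a : Fin n → ℕ | HasDecay g (fun i => (a i : ℝ) + 1) c}
  have hev : ∀ᶠ ε in 𝓝[>] (0 : ℝ), ∀ b ∈ F, HasDecay g (fun i => (b i : ℝ) + 1) (c + ε) := by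
    refine (Filter.eventually_all_finset F).2 fun b hb => ?_
    obtain ⟨ε, hε, h⟩ := (hF1 b hb).exists_gt hc
    filter_upwards [Ioo_mem_nhdsGT hε] with δ hδ
    exact h.anti hg (by linarith [hδ.2])
  obtain ⟨ε, h, hε⟩ := (hev.and self_mem_nhdsWithin).exists
  refine ⟨ε, hε, fun a ha => ?_⟩
  obtain ⟨b, hb, hba⟩ := hF2 a ha
  refine (h b hb).mono fun i => ?_
  have : (b i : ℝ) ≤ a i := by exact_mod_cast hba i
  linarith

/-- The exponent `b` with `b + 1 = m (a + 1)`. -/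
theorem exists_scaled_exponent {m : ℕ} (hm : 1 ≤ m) (a : Fin n → ℕ) :
    ∃ b : Fin n → ℕ, (fun i => (b i : ℝ) + 1) = (m : ℝ) • fun i => (a i : ℝ) + 1 := by
  refine ⟨fun i => m * (a i + 1) - 1, ?_⟩
  funext i
  have h : 1 ≤ m * (a i + 1) := Nat.mul_pos hm (Nat.succ_pos _)
  simp only [Pi.smul_apply, smul_eq_mul]
  rw [Nat.cast_sub h]
  push_cast
  ring

end JumpingNumbers

/-! ### The jump at `m * c`. -/

theorem theorem5p3 (n : ℕ) (φ : (Fin n → ℂ) → EReal)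
    (hφ : IsPlurisubharmonicOn φ (unitPolydisk n)) (htoric : IsToricOn φ (unitPolydisk n))
    (c : ℝ) (hc : IsJumpingNumber φ 0 c) (m : ℕ) (hm : 1 ≤ m) :
    IsJumpingNumber φ 0 ((m : ℝ) * c) := by
  obtain ⟨hc0, δ, hδ, hiff, hlt⟩ := hc
  by_cases hbot : ∃ x : Fin n → ℝ, (∀ i, x i < 0) ∧ φ (expPoint x) = ⊥
  · obtain ⟨x, hx, hbx⟩ := hbot
    exact absurd (multiplierIdeal_le_of_eq_bot hφ htoric hx hbx hc0 (by linarith)) hlt.not_ge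
  push Not at hbot
  have hfin : ∀ x : Fin n → ℝ, (∀ i, x i < 0) → φ (expPoint x) = (logProfile φ x : EReal) :=
    fun x hx => (EReal.coe_toReal (hφ.lt_top _ (expPoint_mem hx)).ne (hbot x hx)).symm
  obtain ⟨R, M, hg⟩ := exists_isLogProfile hφ htoric hfin
  set D : ℝ → (Fin n → ℕ) → Prop := fun c a =>
    HasDecay (logProfile φ) (fun i => (a i : ℝ) + 1) c with hD
  set J : ℝ → Ideal (HolomorphicGerm (0 : Fin n → ℂ)) := fun c =>
    multiplierIdeal (fun z => (c : EReal) * φ z) 0 with hJ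
  have hle : ∀ {c c' : ℝ}, 0 < c → 0 < c' → (J c ≤ J c' ↔ ∀ a, D c a → D c' a) := by
    intro c c' hc hc'
    have h : ∀ {c : ℝ}, 0 < c → ∀ a : Fin n → ℕ, IsL2Near φ c (monomialFn a) ↔ D c a :=
      fun hc a => ⟨hasDecay_of_isL2Near_monomialFn htoric hfin hg hc.le,
        isL2Near_monomialFn_of_hasDecay htoric hfin⟩
    simp only [hJ, multiplierIdeal_le_iff hφ htoric hc.le hc'.le, h hc, h hc']
  have hanti : ∀ {c c' : ℝ}, 0 < c → c ≤ c' → J c' ≤ J c := fun hc hcc' =>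
    (hle (hc.trans_le hcc') hc).2 fun a h => h.anti hg hcc'
  have hright : ∀ {c : ℝ}, 0 < c → ∃ ε > 0, J c ≤ J (c + ε) := by
    intro c hc
    obtain ⟨ε, hε, h⟩ := exists_gt_forall_hasDecay hg hc
    exact ⟨ε, hε, (hle hc (by linarith)).2 h⟩
  have hm0 : (0 : ℝ) < m := by exact_mod_cast hm
  -- Test the inclusion at level `m` only on exponents `b` with `b + 1 = m (a + 1)`. The converse is
  -- not claimed: other exponents may cause additional jumps.
  have hscale : ∀ {c c' : ℝ}, 0 < c → 0 < c' → J (m * c) ≤ J (m * c') → J c ≤ J c' := by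
    intro c c' hc hc' h
    rw [hle (by positivity) (by positivity)] at h
    rw [hle hc hc']
    intro a ha
    obtain ⟨b, hb⟩ := exists_scaled_exponent hm a
    have := h b
    simp only [hD, hb, hasDecay_smul_iff hm0] at this
    exact this ha
  have hmc : 0 < m * c := by positivity
  -- Its supremum is the length of the constancy interval. It may be smaller than `m * δ`, and
  -- right-continuity makes it positive and not attained.
  set T : Set ℝ := {d | 0 < d ∧ J (m * c) ≤ J (m * c + d)} with hT
  have hTbdd : ∀ d ∈ T, d < m * δ := by
    rintro d ⟨hd, h⟩
    by_contra hcon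
    refine hlt.not_ge (hscale hc0 (by linarith) (h.trans ?_))
    exact hanti (by positivity) (by rw [mul_add]; linarith)
  obtain ⟨ε, hε, hεJ⟩ := hright hmc
  have hbdd : BddAbove T := ⟨m * δ, fun d hd => (hTbdd d hd).le⟩
  set δ' := sSup T with hδ'
  have hδ'0 : 0 < δ' := lt_of_lt_of_le hε (le_csSup hbdd ⟨hε, hεJ⟩)
  have hnot : ¬ J (m * c) ≤ J (m * c + δ') := by
    intro h
    obtain ⟨ε', hε', h'⟩ := hright (c := m * c + δ') (by positivity)
    have : δ' + ε' ≤ δ' := le_csSup hbdd ⟨by positivity, h.trans (by rwa [← add_assoc])⟩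
    linarith
  refine ⟨hmc, δ', hδ'0, fun s hs => ⟨fun h => ?_, fun h => ?_⟩, ?_⟩
  · have h : J s = J (m * c) := h
    constructor
    · by_contra! hcon
      -- Equality of ideals at `s < m * c` would descend to equality at `s / m < c`, contrary to `c`
      -- being a jumping number.
      have hsm : m * (s / m) = s := by field_simp
      have hlt' : s / m < c := by
        rw [div_lt_iff₀ hm0]; linarith
      have h1 : J (s / m) ≤ J c := hscale (by positivity) hc0 (by rw [hsm]; exact h.le)
      have h2 := (hiff (s / m) (by positivity)).1 (le_antisymm h1 (hanti (by positivity) hlt'.le))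
      exact absurd h2.1 (not_le.2 hlt')
    · by_contra! hcon
      exact hnot (h.ge.trans (hanti (by positivity) hcon))
  · refine le_antisymm (hanti hmc h.1) ?_
    change J (m * c) ≤ J s
    obtain ⟨d, hd, hsd⟩ := exists_lt_of_lt_csSup (s := T) ⟨ε, hε, hεJ⟩
      (show s - m * c < sSup T by linarith [h.2])
    exact hd.2.trans (hanti hs (by linarith))
  · exact lt_of_le_not_ge (hanti hmc (by linarith)) hnot
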